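/- Let $1\le m<n$ be integers and $r>0$. A stochastic bandit instance is a product distribution $\nu=(\nu_1,\dots,\nu_n)$ of probability measures on $[0,1]$ with means $\mu_1,\dots,\mu_n$; write $\mu_{i^*}=\max_i\mu_i$ and $\Delta_i=\mu_{i^*}-\mu_i$. A (possibly randomized) algorithm repeatedly pulls an arm and observes an independent reward from the law of that arm; it stops at a stopping time $T\in\{0,1,2,\dots\}\cup\{\infty\}$ and then outputs a set $S_T$ of exactly $m$ arms. It is an $r$-BAR (best arm retention) algorithm if on every instance $\mathbb E\big[(\mu_{i^*}-\max_{i\in S_T}\mu_i)\,\mathbf 1\{T<\infty\}\big]<r$. Its regret on $\nu$ is $\mathbb E\big[\sum_{i=1}^n\Delta_iT_i\big]\in[0,\infty]$, where $T_i$ is the number of pulls of arm $i$ before stopping, and its regret complexity is the supremum of its regret over all instances. (1) There is a universal constant $C>0$ such that for all $1\le m<n$ and $r>0$ there is an $r$-BAR algorithm, with a deterministic number of samples, whose regret complexity is at most $$C\cdot\frac{(n-m)^2}{nr}\left(1+\sqrt{\frac{m}{n-m}}\right).$$ (2) For every $\beta\in(0,1)$ there is a constant $c>0$, depending only on $\beta$,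 such that for all $1\le m<n$ and all $0<r\le(1-\beta)\frac{n-m}{n}$, every $r$-BAR algorithm (whether or not it stops almost surely) has regret complexity at least $$c\cdot\frac{(n-m)^2}{nr}.$$ -/

import Mathlib

open MeasureTheory
open scoped ENNReal unitInterval

noncomputable section

/-- A stochastic bandit instance with `n` arms: the reward law of each arm, a probability measure
on the unit interval. -/
abbrev BanditInstance (n : ℕ) : Type := Fin n → ProbabilityMeasure I

namespace BanditInstance

variable {n : ℕ} (ν : BanditInstance n)

/-- The mean reward of arm `i`. -/
def mean (i : Fin n) : ℝ := ∫ x, (x : ℝ) ∂(ν i : Measure I)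

/-- The largest mean reward. -/
def bestMean : ℝ := ⨆ i, ν.mean i

/-- The mean gap between the best arm and arm `i`. -/
def gap (i : Fin n) : ℝ := ν.bestMean - ν.mean i

/-- The difference between the largest mean and the largest mean among the arms of `S`. -/
def setGap (S : Finset (Fin n)) : ℝ := ν.bestMean - ⨆ i : S, ν.mean i

/-- The law of the reward table: its rows (one per round) are independent, and each row follows
the product distribution of the instance. In round `t` (counted from `0`) the player sees the
entry of row `t` that belongs to the arm it pulls, and nothing else. -/
def tableLaw : Measure (ℕ → Fin n → I) :=
  Measure.infinitePi fun _ => Measure.pi fun i => (ν i : Measure I)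

end BanditInstance

/-- What the player has observed after `t` rounds: the pulled arms and the rewards received. -/
abbrev History (n t : ℕ) : Type := Fin t → Fin n × I

/-- A randomized sequential algorithm that retains `m` out of `n` arms. All internal randomness
is carried by a seed, drawn before the game starts and independent of the rewards. After `t`
rounds the algorithm decides, from the seed and the history, whether to stop; if it stops, it
outputs a set of exactly `m` arms, otherwise it pulls one more arm. -/
structure BARAlgorithm (n m : ℕ) where
  Seed : Type
  [seedSpace : MeasurableSpace Seed]
  seedLaw : Measure Seed
  [seedProb : IsProbabilityMeasure seedLaw]
  pull : (t : ℕ) → Seed × History n t → Fin n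
  measurable_pull : ∀ t, Measurable (pull t)
  halt : (t : ℕ) → Set (Seed × History n t)
  measurableSet_halt : ∀ t, MeasurableSet (halt t)
  output : (t : ℕ) → Seed × History n t → Finset (Fin n)
  card_output : ∀ t p, (output t p).card = m
  measurable_output : ∀ t S, MeasurableSet (output t ⁻¹' {S})

attribute [instance] BARAlgorithm.seedSpace BARAlgorithm.seedProb

namespace BARAlgorithm

variable {n m : ℕ} (A : BARAlgorithm n m)

/-- The sample space of a run of the algorithm: a seed and a reward table. -/
abbrev Outcome : Type := A.Seed × (ℕ → Fin n → I)

/-- The law of a run of the algorithm on the instance `ν`. -/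
def law (ν : BanditInstance n) : Measure A.Outcome := A.seedLaw.prod ν.tableLaw

/-- The history after `t` rounds, if the stopping decisions are disregarded. -/
def history (ω : A.Outcome) : (t : ℕ) → History n t
  | 0 => Fin.elim0
  | t + 1 =>
    Fin.snoc (α := fun _ => Fin n × I) (history ω t)
      (A.pull t (ω.1, history ω t), ω.2 t (A.pull t (ω.1, history ω t)))

/-- The arm pulled in round `t`, if the stopping decisions are disregarded. -/
def arm (ω : A.Outcome) (t : ℕ) : Fin n := A.pull t (ω.1, A.history ω t)

/-- The number `T` of samples: the first time at which the algorithm stops, `⊤` if it never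
stops. -/
def sampleSize (ω : A.Outcome) : ℕ∞ :=
  ⨅ (t : ℕ) (_ : (ω.1, A.history ω t) ∈ A.halt t), (t : ℕ∞)

/-- The retained set of arms; meaningful when the algorithm stops. -/
def retained (ω : A.Outcome) : Finset (Fin n) :=
  A.output (A.sampleSize ω).toNat (ω.1, A.history ω (A.sampleSize ω).toNat)

open Classical in
/-- The number `T_i` of times arm `i` is pulled before the algorithm stops. -/
def pullCount (ω : A.Outcome) (i : Fin n) : ℝ≥0∞ :=
  ∑' t : ℕ, if (t : ℕ∞) < A.sampleSize ω ∧ A.arm ω t = i then 1 else 0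

/-- The expected regret `𝔼[∑ i, Δ i * T i]` on the instance `ν`; possibly infinite. -/
def regret (ν : BanditInstance n) : ℝ≥0∞ :=
  ∫⁻ ω, ∑ i, ENNReal.ofReal (ν.gap i) * A.pullCount ω i ∂(A.law ν)

/-- The regret complexity of the algorithm: its worst-case expected regret. -/
def regretComplexity : ℝ≥0∞ := ⨆ ν : BanditInstance n, A.regret ν

open Classical in
/-- The expected gap between the best arm and the best retained arm on the instance `ν`.
Runs that never stop retain nothing; they contribute `0`, so that no requirement is placed on
them. -/
def expectedGap (ν : BanditInstance n) : ℝ≥0∞ :=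
  ∫⁻ ω, (if A.sampleSize ω = ⊤ then 0 else ENNReal.ofReal (ν.setGap (A.retained ω))) ∂(A.law ν)

/-- The algorithm solves `r`-BAR: on every instance the expected gap is less than `r`. -/
def IsRBAR (r : ℝ) : Prop := ∀ ν : BanditInstance n, A.expectedGap ν < ENNReal.ofReal r

/-- The algorithm always stops after exactly `N` samples. -/
def HasFixedSampleSize (N : ℕ) : Prop := ∀ ω, A.sampleSize ω = N

end BARAlgorithm

end

/-!
Write `k = n - m` for the number of arms to be dropped.

*Lower bound.* On the flat instance all arms are Bernoulli with the same mean; on the spiked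
instance `spike b q i` the mean of arm `i` is raised by `Δ`, a multiple of `n r / k`. Let
`N ≈ k / Δ²`. If on the flat instance the algorithm stopped within `N` rounds with probability
close to `1`, then the probabilities of dropping arm `i` would sum to almost `k` over `i`. Passing
to the spiked instances changes this sum by little, since the relative entropies up to round `N` sum
to at most a multiple of `N Δ²`; but the `r`-BAR property bounds each of these probabilities by
`r / Δ`. So with probability bounded below the flat run lasts more than `N` rounds, and it spends
at most half of them on arm `i` for all but one `i`. By the same comparison this persists on
some spiked instance, where it costs regret `Δ N / 2 ≈ k / Δ ≈ k² / (n r)`. Only the first `N`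
rounds matter, so runs that never stop need no separate treatment. The comparison is
`mul_measureReal_le_of_density`; it combines `lintegral_eq_likelihood` with the inequality
`z * exp g ≥ 1 + g + log z`.

*Upper bound.* If `r > k / n`, dropping `k` random arms without sampling is enough. Otherwise let
`T ≈ k³ / (n r)²` and play two phases of `T` rounds. The first phase plays a bandit algorithm of
regret `O(√(n T))` on all arms and ends with an arm `J` drawn from its empirical distribution of
pulls, whose expected gap is `O(√(n / T))`. The second plays the same algorithm on `J` and a random
cyclic block of `k + 1` arms; it ends with an arm `J'` drawn likewise, and `k` arms of the block
other than `J'` are dropped. Comparing the second phase with `J` bounds its regret by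
`T · O(√(n / T)) + O(√(k T))`, so the total regret is `O(√(n T))`, which is the claimed bound.
A best arm is dropped only if it lies in the block, which has probability `(k + 1) / n`; then
comparing the second phase with that arm shows that the expected gap of `J'` is `O(√(k / T))`, for
an expected loss of `O((k / n) √(k / T)) < r`.

The bandit algorithm is follow-the-regularized-leader with the `1/2`-Tsallis entropy, which has no
logarithmic factor in its regret. Its analysis `Tsallis.sum_loss_le` is an inequality that holds on
every path, so that only the expectations of three explicit sums remain, and these follow round by
round from `Policy.lintegral_arm_reward`.
-/

open MeasureTheory
open scoped ENNReal unitInterval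

noncomputable section

/-! ### Runs of an algorithm, one round at a time -/

/-- Redrawing one coordinate independently does not change the law of an independent sequence. -/
theorem measurePreserving_update_infinitePi {X : Type*} [MeasurableSpace X] (μ : ℕ → Measure X)
    [∀ i, IsProbabilityMeasure (μ i)] (t : ℕ) :
    MeasurePreserving (fun q : (ℕ → X) × X => Function.update q.1 t q.2)
      ((Measure.infinitePi μ).prod (μ t)) (Measure.infinitePi μ) := by
  have hm : Measurable (fun q : (ℕ → X) × X => Function.update q.1 t q.2) := measurable_update'
  refine ⟨hm, Measure.eq_infinitePi μ fun s B hB => ?_⟩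
  rw [Measure.map_apply hm (.pi s.countable_toSet fun _ _ => hB _)]
  have hpre : (fun q : (ℕ → X) × X => Function.update q.1 t q.2) ⁻¹' (Set.pi s B)
      = Set.pi (s.erase t : Finset ℕ) B ×ˢ (if t ∈ s then B t else Set.univ) := by
    ext ⟨x, y⟩
    simp only [Set.mem_preimage, Set.mem_pi, Set.mem_prod, Finset.coe_erase, Set.mem_sdiff,
      Finset.mem_coe, Set.mem_singleton_iff, and_imp]
    constructor
    · intro h
      refine ⟨fun i hi hne => by simpa [hne] using h i hi, ?_⟩
      split_ifs with ht
      · simpa using h t ht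
      · trivial
    · rintro ⟨h1, h2⟩ i hi
      rcases eq_or_ne i t with rfl | hne
      · simpa [hi] using h2
      · simpa [hne] using h1 i hi hne
  rw [hpre, Measure.prod_prod, Measure.infinitePi_pi _ fun i _ => hB i]
  split_ifs with ht
  · rw [Finset.prod_erase_mul _ _ ht]
  · rw [measure_univ, mul_one, Finset.erase_eq_of_notMem ht]

theorem lintegral_infinitePi_update {X : Type*} [MeasurableSpace X] (μ : ℕ → Measure X)
    [∀ i, IsProbabilityMeasure (μ i)] (t : ℕ) {F : (ℕ → X) → ℝ≥0∞} (hF : Measurable F) :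
    ∫⁻ x, F x ∂Measure.infinitePi μ
      = ∫⁻ x, ∫⁻ y, F (Function.update x t y) ∂μ t ∂Measure.infinitePi μ := by
  have h := measurePreserving_update_infinitePi μ t
  rw [← h.lintegral_comp hF, lintegral_prod]
  exact (hF.comp h.measurable).aemeasurable

/-- The expected value of `φ` under the law of an arm that depends measurably on a parameter. -/
theorem BanditInstance.measurable_lintegral {n : ℕ} (ν : BanditInstance n) {P : Type*}
    [MeasurableSpace P] {φ : P × I → ℝ≥0∞} (hφ : Measurable φ) {a : P → Fin n}
    (ha : Measurable a) : Measurable fun p => ∫⁻ x, φ (p, x) ∂(ν (a p) : Measure I) := by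
  have : ProbabilityTheory.IsMarkovKernel
      (ProbabilityTheory.Kernel.ofFunOfCountable fun j => (ν j : Measure I)) :=
    ⟨fun j => inferInstanceAs (IsProbabilityMeasure (ν j : Measure I))⟩
  exact hφ.lintegral_kernel_prod_right' (κ := ProbabilityTheory.Kernel.comap
    (ProbabilityTheory.Kernel.ofFunOfCountable fun j => (ν j : Measure I)) a ha)

namespace BARAlgorithm

variable {n m : ℕ} (A : BARAlgorithm n m)

instance (ν : BanditInstance n) : IsProbabilityMeasure ν.tableLaw := by
  unfold BanditInstance.tableLaw; infer_instance

instance (ν : BanditInstance n) : IsProbabilityMeasure (A.law ν) := by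
  unfold law; infer_instance

theorem measurable_snoc {P : Type*} [MeasurableSpace P] {t : ℕ} {h : P → History n t}
    {x : P → Fin n × I} (hh : Measurable h) (hx : Measurable x) :
    Measurable fun p => (Fin.snoc (α := fun _ => Fin n × I) (h p) (x p) : History n (t + 1)) := by
  refine measurable_pi_lambda _ fun i => ?_
  refine Fin.lastCases ?_ (fun j => ?_) i
  · simpa only [Fin.snoc_last] using hx
  · simp only [Fin.snoc_castSucc]
    exact (measurable_pi_apply j).comp hh

theorem measurable_history (t : ℕ) : Measurable fun ω : A.Outcome => A.history ω t := by
  induction t with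
  | zero => exact measurable_const
  | succ t ih =>
    have hp : Measurable fun ω : A.Outcome => A.pull t (ω.1, A.history ω t) :=
      (A.measurable_pull t).comp (measurable_fst.prodMk ih)
    have hr : Measurable fun q : (Fin n → I) × Fin n => q.1 q.2 :=
      measurable_from_prod_countable_left fun j => measurable_pi_apply j
    exact measurable_snoc ih (hp.prodMk
      (hr.comp (((measurable_pi_apply t).comp measurable_snd).prodMk hp)))

theorem measurable_arm (t : ℕ) : Measurable fun ω : A.Outcome => A.arm ω t :=
  (A.measurable_pull t).comp (measurable_fst.prodMk (A.measurable_history t))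

theorem measurable_reward (t : ℕ) : Measurable fun ω : A.Outcome => ω.2 t (A.arm ω t) := by
  have hr : Measurable fun q : (Fin n → I) × Fin n => q.1 q.2 :=
    measurable_from_prod_countable_left fun j => measurable_pi_apply j
  exact hr.comp (((measurable_pi_apply t).comp measurable_snd).prodMk (A.measurable_arm t))

/-- The history after `t` rounds does not depend on the rewards of round `t` and later. -/
theorem history_update (s : A.Seed) (x : ℕ → Fin n → I) {t u : ℕ} (htu : t ≤ u) (y : Fin n → I) :
    A.history (s, Function.update x u y) t = A.history (s, x) t := by
  induction t with
  | zero => rfl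
  | succ t ih =>
    have ht : t ≠ u := by omega
    simp only [history, ih (by omega), Function.update_of_ne ht]

/-- The reward seen in round `t` is a fresh sample from the law of the pulled arm. -/
theorem lintegral_reward (ν : BanditInstance n) (t : ℕ) {φ : (A.Seed × History n t) × I → ℝ≥0∞}
    (hφ : Measurable φ) :
    ∫⁻ ω, φ ((ω.1, A.history ω t), ω.2 t (A.arm ω t)) ∂A.law ν
      = ∫⁻ ω, ∫⁻ x, φ ((ω.1, A.history ω t), x) ∂(ν (A.arm ω t) : Measure I) ∂A.law ν := by
  have hh := A.measurable_history t
  have ha := A.measurable_arm t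
  have hF : Measurable fun ω : A.Outcome => φ ((ω.1, A.history ω t), ω.2 t (A.arm ω t)) :=
    hφ.comp ((measurable_fst.prodMk hh).prodMk (A.measurable_reward t))
  have hker : Measurable fun ω : A.Outcome =>
      ∫⁻ x, φ ((ω.1, A.history ω t), x) ∂(ν (A.arm ω t) : Measure I) :=
    ν.measurable_lintegral (hφ.comp (((measurable_fst.prodMk hh).comp measurable_fst).prodMk
      measurable_snd)) ha
  unfold law
  rw [lintegral_prod _ hF.aemeasurable, lintegral_prod _ hker.aemeasurable]
  refine lintegral_congr fun s => ?_
  have hs : Measurable fun x : ℕ → Fin n → I =>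
      φ ((s, A.history (s, x) t), x t (A.arm (s, x) t)) := hF.comp measurable_prodMk_left
  unfold BanditInstance.tableLaw
  rw [lintegral_infinitePi_update _ t hs]
  refine lintegral_congr fun x => ?_
  simp only [arm, A.history_update s x le_rfl, Function.update_self]
  exact (measurePreserving_eval (fun i => (ν i : Measure I))
    (A.pull t (s, A.history (s, x) t))).lintegral_comp (hφ.comp measurable_prodMk_left)

end BARAlgorithm

/-! ### Change of measure -/

namespace BARAlgorithm

variable {n m : ℕ} (A : BARAlgorithm n m)

theorem history_apply (ω : A.Outcome) (N : ℕ) (s : Fin N) :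
    A.history ω N s = (A.arm ω s, ω.2 s (A.arm ω s)) := by
  induction N with
  | zero => exact s.elim0
  | succ N ih =>
    refine Fin.lastCases ?_ (fun j => ?_) s
    · simp [history, arm]
    · simp [history, ih]

theorem history_castLE (ω : A.Outcome) {t N : ℕ} (h : t ≤ N) :
    A.history ω t = fun s => A.history ω N (Fin.castLE h s) := by
  ext1 s
  simp [history_apply]

/-- The information available after `N` rounds: the seed and the history. -/
abbrev info (N : ℕ) : MeasurableSpace A.Outcome :=
  MeasurableSpace.comap (fun ω => (ω.1, A.history ω N)) inferInstance

theorem measurableSet_info {t N : ℕ} (h : t ≤ N) {B : Set (A.Seed × History n t)}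
    (hB : MeasurableSet B) : MeasurableSet[A.info N] {ω | (ω.1, A.history ω t) ∈ B} := by
  have hm : Measurable fun q : A.Seed × History n N =>
      ((q.1, fun s => q.2 (Fin.castLE h s)) : A.Seed × History n t) := by fun_prop
  refine ⟨_, hm hB, ?_⟩
  ext ω
  simp only [Set.mem_preimage, Set.mem_ofPred_eq, A.history_castLE ω h]

theorem measurableSet_of_info {N : ℕ} {E : Set A.Outcome} (hE : MeasurableSet[A.info N] E) :
    MeasurableSet E := by
  obtain ⟨F, hF, rfl⟩ := hE
  exact (measurable_fst.prodMk (A.measurable_history N)) hF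

theorem measurableSet_info_arm {t N : ℕ} (h : t ≤ N) (i : Fin n) :
    MeasurableSet[A.info N] {ω | A.arm ω t = i} :=
  A.measurableSet_info h (A.measurable_pull t (measurableSet_singleton i))

/-- The likelihood ratio of a history when the law of arm `i` is reweighted by the density `f`. -/
def likelihood (i : Fin n) (f : I → ℝ≥0∞) {N : ℕ} (h : History n N) : ℝ≥0∞ :=
  ∏ t, if (h t).1 = i then f (h t).2 else 1

theorem measurable_likelihood (i : Fin n) {f : I → ℝ≥0∞} (hf : Measurable f) (N : ℕ) :
    Measurable fun h : History n N => likelihood i f h := by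
  refine Finset.measurable_prod _ fun t _ => ?_
  refine Measurable.ite ?_ (hf.comp (measurable_snd.comp (measurable_pi_apply t))) measurable_const
  exact (measurable_fst.comp (measurable_pi_apply t)) (measurableSet_singleton i)

theorem lintegral_succ (ν : BanditInstance n) (N : ℕ)
    {φ : A.Seed × History n (N + 1) → ℝ≥0∞} (hφ : Measurable φ) :
    ∫⁻ ω, φ (ω.1, A.history ω (N + 1)) ∂A.law ν
      = ∫⁻ ω, ∫⁻ x, φ (ω.1, Fin.snoc (α := fun _ => Fin n × I) (A.history ω N) (A.arm ω N, x))
          ∂(ν (A.arm ω N) : Measure I) ∂A.law ν := by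
  refine A.lintegral_reward ν N (φ := fun q => φ (q.1.1,
    Fin.snoc (α := fun _ => Fin n × I) q.1.2 (A.pull N q.1, q.2))) (hφ.comp ?_)
  exact (measurable_fst.comp measurable_fst).prodMk (measurable_snoc
    (measurable_snd.comp measurable_fst)
    (((A.measurable_pull N).comp measurable_fst).prodMk measurable_snd))

/-- If two instances differ only in the law of arm `i`, the laws of the history differ by the
likelihood ratio: the sampling rule is the same and cancels. -/
theorem lintegral_eq_likelihood {ν ν' : BanditInstance n} {i : Fin n} {f : I → ℝ≥0∞}
    (hf : Measurable f) (hi : (ν' i : Measure I) = (ν i : Measure I).withDensity f)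
    (hne : ∀ j, j ≠ i → ν' j = ν j) (N : ℕ)
    {φ : A.Seed × History n N → ℝ≥0∞} (hφ : Measurable φ) :
    ∫⁻ ω, φ (ω.1, A.history ω N) ∂A.law ν'
      = ∫⁻ ω, likelihood i f (A.history ω N) * φ (ω.1, A.history ω N) ∂A.law ν := by
  induction N with
  | zero =>
    have key : ∀ ν : BanditInstance n, ∫⁻ ω, φ (ω.1, A.history ω 0) ∂A.law ν
        = ∫⁻ s, φ (s, Fin.elim0) ∂A.seedLaw := by
      intro ν
      have h0 : Measurable fun ω : A.Outcome => φ (ω.1, A.history ω 0) :=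
        hφ.comp (measurable_fst.prodMk (A.measurable_history 0))
      unfold law
      rw [lintegral_prod _ h0.aemeasurable]
      simp [history]
    simp only [likelihood, Finset.univ_eq_empty, Finset.prod_empty, one_mul]
    rw [key, key]
  | succ N ih =>
    have hsnoc : Measurable fun q : (A.Seed × History n N) × I =>
        ((q.1.1, Fin.snoc (α := fun _ => Fin n × I) q.1.2 (A.pull N q.1, q.2)) :
          A.Seed × History n (N + 1)) :=
      (measurable_fst.comp measurable_fst).prodMk (measurable_snoc
        (measurable_snd.comp measurable_fst)
        (((A.measurable_pull N).comp measurable_fst).prodMk measurable_snd))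
    rw [A.lintegral_succ ν' N hφ, A.lintegral_succ ν N
      (φ := fun q => likelihood i f q.2 * φ q)
      (((measurable_likelihood i hf _).comp measurable_snd).mul hφ)]
    refine (ih (φ := fun q => ∫⁻ x, φ (q.1, Fin.snoc (α := fun _ => Fin n × I) q.2 (A.pull N q, x))
      ∂(ν' (A.pull N q) : Measure I))
      (ν'.measurable_lintegral (hφ.comp hsnoc) (A.measurable_pull N))).trans ?_
    refine lintegral_congr fun ω => ?_
    have hs : Measurable fun x : I =>
        φ (ω.1, Fin.snoc (α := fun _ => Fin n × I) (A.history ω N) (A.arm ω N, x)) :=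
      (hφ.comp hsnoc).comp (measurable_prodMk_left (x := (ω.1, A.history ω N)))
    have hlik : ∀ x : I, likelihood i f
        (Fin.snoc (α := fun _ => Fin n × I) (A.history ω N) (A.arm ω N, x) : History n (N + 1))
        = likelihood i f (A.history ω N) * (if A.arm ω N = i then f x else 1) := by
      intro x
      simp only [likelihood, Fin.prod_univ_castSucc, Fin.snoc_castSucc, Fin.snoc_last]
    simp only [hlik, mul_assoc]
    rw [lintegral_const_mul]
    · congr 1
      change ∫⁻ x, φ (ω.1, Fin.snoc (α := fun _ => Fin n × I) (A.history ω N) (A.arm ω N, x))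
        ∂(ν' (A.arm ω N) : Measure I) = _
      by_cases h : A.arm ω N = i
      · rw [h] at hs ⊢
        rw [hi, lintegral_withDensity_eq_lintegral_mul _ hf hs]
        simp
      · rw [hne _ h]
        simp [h]
    · refine Measurable.mul ?_ hs
      split_ifs
      exacts [hf, measurable_const]

theorem lintegral_sum_reward (ν : BanditInstance n) (i : Fin n) {g : I → ℝ≥0∞}
    (hg : Measurable g) (N : ℕ) :
    ∫⁻ ω, ∑ t ∈ Finset.range N, (if A.arm ω t = i then g (ω.2 t (A.arm ω t)) else 0) ∂A.law ν
      = (∑ t ∈ Finset.range N, A.law ν {ω | A.arm ω t = i}) * ∫⁻ x, g x ∂(ν i : Measure I) := by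
  have hset : ∀ t, MeasurableSet {ω | A.arm ω t = i} := fun t =>
    A.measurable_arm t (measurableSet_singleton i)
  have hsum : ∀ t ∈ Finset.range N, Measurable fun ω : A.Outcome =>
      if A.arm ω t = i then g (ω.2 t (A.arm ω t)) else 0 := fun t _ =>
    Measurable.ite (hset t) (hg.comp (A.measurable_reward t)) measurable_const
  rw [lintegral_finsetSum _ hsum, Finset.sum_mul]
  refine Finset.sum_congr rfl fun t _ => ?_
  refine (A.lintegral_reward ν t (φ := fun q => if A.pull t q.1 = i then g q.2 else 0)
    (Measurable.ite (((A.measurable_pull t).comp measurable_fst) (measurableSet_singleton i))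
      (hg.comp measurable_snd) measurable_const)).trans ?_
  rw [mul_comm, ← setLIntegral_const, ← lintegral_indicator (hset t)]
  refine lintegral_congr fun ω => ?_
  change ∫⁻ x, (if A.arm ω t = i then g x else 0) ∂(ν (A.arm ω t) : Measure I) = _
  by_cases h : A.arm ω t = i
  · simp [h]
  · simp [h]

theorem likelihood_history (i : Fin n) (f : I → ℝ≥0∞) (ω : A.Outcome) (N : ℕ) :
    likelihood i f (A.history ω N)
      = ∏ t ∈ Finset.range N, if A.arm ω t = i then f (ω.2 t (A.arm ω t)) else 1 := by
  simp only [likelihood, history_apply]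
  exact (Finset.prod_range
    (fun t => if A.arm ω t = i then f (ω.2 t (A.arm ω t)) else 1)).symm

/-- A tangent-line bound for a product of likelihood ratios: `z * exp g ≥ 1 + g + log z`, and
`log y ≥ 1 - y⁻¹` for each factor `y` of `z`. -/
theorem one_add_sum_le_prod_mul_exp {ι : Type*} (s : Finset ι) (y : ι → ℝ) (hy : ∀ j, 0 < y j)
    (P : ι → Prop) [DecidablePred P] {g : ℝ} (hg : 0 ≤ g) :
    1 + ENNReal.ofReal g + ∑ j ∈ s, (if P j then (1 : ℝ≥0∞) else 0)
      ≤ (∏ j ∈ s, if P j then ENNReal.ofReal (y j) else 1) * ENNReal.ofReal (Real.exp g)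
        + ∑ j ∈ s, if P j then ENNReal.ofReal (y j)⁻¹ else 0 := by
  have e1 : ∑ j ∈ s, (if P j then (1 : ℝ≥0∞) else 0)
      = ENNReal.ofReal (∑ j ∈ s, if P j then 1 else 0) := by
    rw [ENNReal.ofReal_sum_of_nonneg fun j _ => by split_ifs <;> simp]
    exact Finset.sum_congr rfl fun j _ => by split_ifs <;> simp
  have e2 : ∑ j ∈ s, (if P j then ENNReal.ofReal (y j)⁻¹ else 0)
      = ENNReal.ofReal (∑ j ∈ s, if P j then (y j)⁻¹ else 0) := by
    rw [ENNReal.ofReal_sum_of_nonneg fun j _ => by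
      split_ifs
      exacts [(inv_pos.2 (hy j)).le, le_rfl]]
    exact Finset.sum_congr rfl fun j _ => by split_ifs <;> simp
  have e3 : (∏ j ∈ s, if P j then ENNReal.ofReal (y j) else 1)
      = ENNReal.ofReal (∏ j ∈ s, if P j then y j else 1) := by
    rw [ENNReal.ofReal_prod_of_nonneg fun j _ => by
      split_ifs
      exacts [(hy j).le, zero_le_one]]
    exact Finset.prod_congr rfl fun j _ => by split_ifs <;> simp
  have hpos : ∀ j, 0 < (if P j then y j else 1) := fun j => by
    split_ifs
    exacts [hy j, zero_lt_one]
  have h1 : 0 ≤ ∑ j ∈ s, if P j then (1 : ℝ) else 0 :=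
    Finset.sum_nonneg fun j _ => by split_ifs <;> simp
  have h2 : 0 ≤ ∑ j ∈ s, if P j then (y j)⁻¹ else 0 :=
    Finset.sum_nonneg fun j _ => by
      split_ifs
      exacts [(inv_pos.2 (hy j)).le, le_rfl]
  have h3 : 0 < ∏ j ∈ s, if P j then y j else 1 := Finset.prod_pos fun j _ => hpos j
  rw [e1, e2, e3, ← ENNReal.ofReal_one, ← ENNReal.ofReal_add zero_le_one hg,
    ← ENNReal.ofReal_add (by positivity) h1, ← ENNReal.ofReal_mul h3.le,
    ← ENNReal.ofReal_add (by positivity) h2]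
  refine ENNReal.ofReal_le_ofReal ?_
  have hlog : ∑ j ∈ s, ((if P j then 1 else 0) - if P j then (y j)⁻¹ else 0)
      ≤ Real.log (∏ j ∈ s, if P j then y j else 1) := by
    rw [Real.log_prod fun j _ => (hpos j).ne']
    refine Finset.sum_le_sum fun j _ => ?_
    split_ifs
    · exact Real.one_sub_inv_le_log_of_pos (hy j)
    · simp
  have hexp := Real.add_one_le_exp (g + Real.log (∏ j ∈ s, if P j then y j else 1))
  rw [Real.exp_add, Real.exp_log h3] at hexp
  rw [Finset.sum_sub_distrib] at hlog
  linarith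

/-- An event decided by the first `N` rounds keeps most of its probability when the law of arm `i`
changes, unless arm `i` is pulled often. Here `f` is the likelihood ratio and `D` bounds the
chi-square divergence of the old law from the new one. -/
theorem mul_measureReal_le_of_density {ν ν' : BanditInstance n} {i : Fin n} {f : I → ℝ}
    (hf : Measurable f) (hf0 : ∀ x, 0 < f x)
    (hi : (ν' i : Measure I) = (ν i : Measure I).withDensity fun x => ENNReal.ofReal (f x))
    (hne : ∀ j, j ≠ i → ν' j = ν j) {D : ℝ} (hD0 : 0 ≤ D)
    (hD : ∫⁻ x, ENNReal.ofReal (f x)⁻¹ ∂(ν i : Measure I) ≤ ENNReal.ofReal (1 + D)) {N : ℕ}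
    {E : Set A.Outcome} (hE : MeasurableSet[A.info N] E) {a : ℝ} (ha : 0 ≤ a) :
    a * (A.law ν).real E ≤ (Real.exp a - 1) * (A.law ν').real E
      + D * ∑ t ∈ Finset.range N, (A.law ν).real {ω | A.arm ω t = i} := by
  classical
  have hEm := A.measurableSet_of_info hE
  obtain ⟨F, hF, rfl⟩ := hE
  have hea : 0 ≤ Real.exp a - 1 := by linarith [Real.add_one_le_exp a]
  set τ : ℝ≥0∞ := ∑ t ∈ Finset.range N, A.law ν {ω | A.arm ω t = i} with hτ
  have hτr : τ = ENNReal.ofReal (∑ t ∈ Finset.range N, (A.law ν).real {ω | A.arm ω t = i}) := by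
    rw [ENNReal.ofReal_sum_of_nonneg fun t _ => measureReal_nonneg]
    simp [hτ]
  set E : Set A.Outcome := (fun ω => (ω.1, A.history ω N)) ⁻¹' F with hEdef
  have hpt : ∀ ω : A.Outcome,
      1 + E.indicator (fun _ => ENNReal.ofReal a) ω
          + ∑ t ∈ Finset.range N, (if A.arm ω t = i then 1 else 0)
        ≤ likelihood i (fun x => ENNReal.ofReal (f x)) (A.history ω N)
            * (1 + F.indicator (fun _ => ENNReal.ofReal (Real.exp a - 1)) (ω.1, A.history ω N))
          + ∑ t ∈ Finset.range N,
            (if A.arm ω t = i then ENNReal.ofReal (f (ω.2 t (A.arm ω t)))⁻¹ else 0) := by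
    intro ω
    rw [likelihood_history]
    by_cases hω : (ω.1, A.history ω N) ∈ F
    · rw [Set.indicator_of_mem (by exact hω), Set.indicator_of_mem hω]
      have := one_add_sum_le_prod_mul_exp (Finset.range N) (fun t => f (ω.2 t (A.arm ω t)))
        (fun t => hf0 _) (fun t => A.arm ω t = i) ha
      rwa [show Real.exp a = 1 + (Real.exp a - 1) by ring, ENNReal.ofReal_add zero_le_one hea,
        ENNReal.ofReal_one] at this
    · rw [Set.indicator_of_notMem (by exact hω), Set.indicator_of_notMem hω]
      have := one_add_sum_le_prod_mul_exp (Finset.range N) (fun t => f (ω.2 t (A.arm ω t)))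
        (fun t => hf0 _) (fun t => A.arm ω t = i) le_rfl
      simpa using this
  have hlik : Measurable fun ω : A.Outcome =>
      likelihood i (fun x => ENNReal.ofReal (f x)) (A.history ω N) :=
    (measurable_likelihood i hf.ennreal_ofReal N).comp (A.measurable_history N)
  have hFi : Measurable fun q : A.Seed × History n N =>
      1 + F.indicator (fun _ => ENNReal.ofReal (Real.exp a - 1)) q :=
    (measurable_const.indicator hF).const_add 1
  have hint := lintegral_mono (μ := A.law ν) hpt
  have hLHS : ∫⁻ ω, (1 + E.indicator (fun _ => ENNReal.ofReal a) ω
      + ∑ t ∈ Finset.range N, (if A.arm ω t = i then 1 else 0)) ∂A.law ν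
      = 1 + ENNReal.ofReal a * A.law ν E + τ := by
    have hm : Measurable fun ω : A.Outcome => 1 + E.indicator (fun _ => ENNReal.ofReal a) ω :=
      (measurable_const.indicator hEm).const_add 1
    rw [lintegral_add_left hm, lintegral_add_left measurable_const, lintegral_indicator hEm,
      setLIntegral_const]
    have := A.lintegral_sum_reward ν i (g := fun _ => 1) measurable_const N
    simp only [lintegral_const, measure_univ, mul_one] at this
    rw [this]
    simp [hτ]
  have hRHS := A.lintegral_eq_likelihood hf.ennreal_ofReal hi hne N hFi
  have hm : Measurable fun ω : A.Outcome =>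
      likelihood i (fun x => ENNReal.ofReal (f x)) (A.history ω N)
        * (1 + F.indicator (fun _ => ENNReal.ofReal (Real.exp a - 1)) (ω.1, A.history ω N)) :=
    hlik.mul (hFi.comp (measurable_fst.prodMk (A.measurable_history N)))
  rw [lintegral_add_left hm, ← hRHS, A.lintegral_sum_reward ν i
    (g := fun x => ENNReal.ofReal (f x)⁻¹) hf.inv.ennreal_ofReal N, hLHS] at hint
  have hR1 : ∫⁻ ω, (1 + F.indicator (fun _ => ENNReal.ofReal (Real.exp a - 1))
      (ω.1, A.history ω N)) ∂A.law ν' = 1 + ENNReal.ofReal (Real.exp a - 1) * A.law ν' E := by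
    have : ∀ ω : A.Outcome, F.indicator (fun _ => ENNReal.ofReal (Real.exp a - 1))
        (ω.1, A.history ω N) = E.indicator (fun _ => ENNReal.ofReal (Real.exp a - 1)) ω :=
      fun ω => rfl
    simp only [this]
    rw [lintegral_add_left measurable_const, lintegral_indicator hEm, setLIntegral_const]
    simp
  rw [hR1, ← hτ] at hint
  have hfin := hint.trans (add_le_add_right (mul_le_mul_right hD τ) _)
  rw [hτr, ← ofReal_measureReal (μ := A.law ν) (s := E),
    ← ofReal_measureReal (μ := A.law ν') (s := E), ← ENNReal.ofReal_one,
    ← ENNReal.ofReal_mul ha, ← ENNReal.ofReal_mul hea,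
    ← ENNReal.ofReal_mul (Finset.sum_nonneg fun t _ => measureReal_nonneg),
    ← ENNReal.ofReal_add zero_le_one (by positivity),
    ← ENNReal.ofReal_add zero_le_one (by positivity),
    ← ENNReal.ofReal_add (by positivity) (Finset.sum_nonneg fun t _ => measureReal_nonneg),
    ← ENNReal.ofReal_add (by positivity) (mul_nonneg
      (Finset.sum_nonneg fun t _ => measureReal_nonneg) (by positivity)),
    ENNReal.ofReal_le_ofReal_iff (add_nonneg (by positivity) (mul_nonneg
      (Finset.sum_nonneg fun t _ => measureReal_nonneg) (by positivity)))] at hfin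
  linarith

end BARAlgorithm

/-! ### Stopping -/

namespace BARAlgorithm

variable {n m : ℕ} (A : BARAlgorithm n m)

theorem sampleSize_le_iff (ω : A.Outcome) (N : ℕ) :
    A.sampleSize ω ≤ N ↔ ∃ t ≤ N, (ω.1, A.history ω t) ∈ A.halt t := by
  constructor
  · intro h
    by_contra! hne
    have : ((N + 1 : ℕ) : ℕ∞) ≤ A.sampleSize ω :=
      le_iInf₂ fun t ht => by
        by_contra! hlt
        exact hne t (Nat.lt_succ_iff.1 (by exact_mod_cast hlt)) ht
    have h2 : ((N + 1 : ℕ) : ℕ∞) ≤ N := this.trans h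
    have h3 : N + 1 ≤ N := by exact_mod_cast h2
    omega
  · rintro ⟨t, ht, hh⟩
    exact (iInf₂_le t hh).trans (by exact_mod_cast ht)

theorem sampleSize_eq_iff (ω : A.Outcome) (t : ℕ) :
    A.sampleSize ω = t ↔
      (ω.1, A.history ω t) ∈ A.halt t ∧ ∀ u < t, (ω.1, A.history ω u) ∉ A.halt u := by
  constructor
  · intro h
    have hnot : ∀ u < t, (ω.1, A.history ω u) ∉ A.halt u := fun u hu hh => by
      have := (A.sampleSize_le_iff ω u).2 ⟨u, le_rfl, hh⟩
      rw [h] at this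
      have : t ≤ u := by exact_mod_cast this
      omega
    obtain ⟨u, hu, hh⟩ := (A.sampleSize_le_iff ω t).1 h.le
    rcases hu.lt_or_eq with hlt | rfl
    · exact absurd hh (hnot u hlt)
    · exact ⟨hh, hnot⟩
  · rintro ⟨h1, h2⟩
    refine le_antisymm ((A.sampleSize_le_iff ω t).2 ⟨t, le_rfl, h1⟩) ?_
    refine le_iInf₂ fun u hu => ?_
    by_contra! hlt
    exact h2 u (by exact_mod_cast hlt) hu

theorem retained_eq {ω : A.Outcome} {t : ℕ} (h : A.sampleSize ω = t) :
    A.retained ω = A.output t (ω.1, A.history ω t) := by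
  simp only [retained]
  rw [h, ENat.toNat_natCast]

theorem measurableSet_info_halted {t N : ℕ} (h : t ≤ N) :
    MeasurableSet[A.info N] {ω | A.sampleSize ω = t} := by
  have : {ω | A.sampleSize ω = t} = {ω | (ω.1, A.history ω t) ∈ A.halt t}
      ∩ ⋂ u : Fin t, {ω | (ω.1, A.history ω u) ∈ A.halt u}ᶜ := by
    ext ω
    simp [A.sampleSize_eq_iff, Fin.forall_iff]
  rw [this]
  refine (A.measurableSet_info h (A.measurableSet_halt t)).inter ?_
  exact MeasurableSet.iInter fun u =>
    (A.measurableSet_info (u.2.le.trans h) (A.measurableSet_halt u)).compl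

/-- The event that the algorithm stops within `N` rounds and drops arm `i`. -/
def dropEvent (N : ℕ) (i : Fin n) : Set A.Outcome :=
  {ω | A.sampleSize ω ≤ N ∧ i ∉ A.retained ω}

theorem measurableSet_info_dropEvent (N : ℕ) (i : Fin n) :
    MeasurableSet[A.info N] (A.dropEvent N i) := by
  have : A.dropEvent N i = ⋃ t : Fin (N + 1), {ω | A.sampleSize ω = (t : ℕ)}
      ∩ {ω | (ω.1, A.history ω t) ∈ A.output t ⁻¹' {S | i ∉ S}} := by
    ext ω
    simp only [dropEvent, Set.mem_ofPred_eq, Set.mem_iUnion, Set.mem_inter_iff, Set.mem_preimage]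
    constructor
    · rintro ⟨h1, h2⟩
      obtain ⟨t, ht⟩ := ENat.ne_top_iff_exists.1 (ne_top_of_le_ne_top (ENat.natCast_ne_top N) h1)
      have htN : t ≤ N := by rw [← ht] at h1; exact_mod_cast h1
      refine ⟨⟨t, by omega⟩, ht.symm, ?_⟩
      simpa [← A.retained_eq ht.symm] using h2
    · rintro ⟨t, h1, h2⟩
      refine ⟨?_, ?_⟩
      · rw [h1]; exact_mod_cast Nat.lt_succ_iff.1 t.2
      · simpa [A.retained_eq h1] using h2
  rw [this]
  refine MeasurableSet.iUnion fun t => ?_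
  have ht : (t : ℕ) ≤ N := Nat.lt_succ_iff.1 t.2
  refine (A.measurableSet_info_halted ht).inter (A.measurableSet_info ht ?_)
  have : A.output t ⁻¹' {S | i ∉ S}
      = ⋃ S : {S : Finset (Fin n) // i ∉ S}, A.output t ⁻¹' {S.1} := by
    ext p
    simp
  rw [this]
  exact MeasurableSet.iUnion fun S => A.measurable_output t S

theorem measurableSet_info_sampleSize_le (N : ℕ) :
    MeasurableSet[A.info N] {ω | A.sampleSize ω ≤ N} := by
  have : {ω | A.sampleSize ω ≤ N}
      = ⋃ t : Fin (N + 1), {ω | (ω.1, A.history ω t) ∈ A.halt t} := by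
    ext ω
    simp only [Set.mem_ofPred_eq, A.sampleSize_le_iff, Set.mem_iUnion]
    constructor
    · rintro ⟨t, ht, h⟩
      exact ⟨⟨t, by omega⟩, h⟩
    · rintro ⟨t, h⟩
      exact ⟨t, by omega, h⟩
  rw [this]
  exact MeasurableSet.iUnion fun t =>
    A.measurableSet_info (Nat.lt_succ_iff.1 t.2) (A.measurableSet_halt t)

/-- The number of pulls of arm `i` in the first `M` rounds, stopping disregarded. -/
def armCount (ω : A.Outcome) (M : ℕ) (i : Fin n) : ℕ :=
  ((Finset.range M).filter fun t => A.arm ω t = i).card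

/-- The event that the algorithm performs at least `N + 1` rounds, at most half of the first
`N + 1` on arm `i`. It is decided by the first `N` rounds. -/
def longEvent (N : ℕ) (i : Fin n) : Set A.Outcome :=
  {ω | (N : ℕ∞) < A.sampleSize ω ∧ 2 * A.armCount ω (N + 1) i ≤ N + 1}

theorem measurableSet_info_longEvent (N : ℕ) (i : Fin n) :
    MeasurableSet[A.info N] (A.longEvent N i) := by
  have h1 : Measurable[A.info N] fun ω : A.Outcome => A.armCount ω (N + 1) i := by
    have : (fun ω : A.Outcome => A.armCount ω (N + 1) i)
        = fun ω => ∑ t ∈ Finset.range (N + 1), if A.arm ω t = i then 1 else 0 := by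
      ext ω
      simp [armCount]
    rw [this]
    refine @Finset.measurable_fun_sum _ _ _ _ _ _ (A.info N) _ _ fun t ht => ?_
    exact Measurable.ite (f := fun _ : A.Outcome => 1) (g := fun _ => 0)
      (A.measurableSet_info_arm (Nat.lt_succ_iff.1 (Finset.mem_range.1 ht)) i)
      (@measurable_const _ _ _ (A.info N) 1) (@measurable_const _ _ _ (A.info N) 0)
  have h2 : A.longEvent N i = {ω | A.sampleSize ω ≤ N}ᶜ
      ∩ (fun ω : A.Outcome => A.armCount ω (N + 1) i) ⁻¹' {c | 2 * c ≤ N + 1} := by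
    ext ω
    simp [longEvent]
  rw [h2]
  exact (A.measurableSet_info_sampleSize_le N).compl.inter (h1 (MeasurableSet.of_discrete))

theorem sum_armCount (ω : A.Outcome) (M : ℕ) : ∑ i, A.armCount ω M i = M := by
  simp only [armCount]
  rw [← Finset.card_eq_sum_card_fiberwise (fun _ _ => Finset.mem_coe.2 (Finset.mem_univ _)),
    Finset.card_range]

theorem armCount_le_pullCount (ω : A.Outcome) {N : ℕ} (h : (N : ℕ∞) < A.sampleSize ω)
    (i : Fin n) : (A.armCount ω (N + 1) i : ℝ≥0∞) ≤ A.pullCount ω i := by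
  classical
  refine le_trans (le_of_eq ?_) (ENNReal.sum_le_tsum (Finset.range (N + 1)))
  simp only [armCount, Finset.card_filter, Nat.cast_sum]
  refine Finset.sum_congr rfl fun t ht => ?_
  have : (t : ℕ∞) < A.sampleSize ω := lt_of_le_of_lt
    (by exact_mod_cast Nat.lt_succ_iff.1 (Finset.mem_range.1 ht)) h
  by_cases ha : A.arm ω t = i <;> simp [this, ha]

end BARAlgorithm

/-! ### Instances with one better arm -/

/-- The Bernoulli law with success probability `p`. -/
def bernoulliLaw (p : I) : ProbabilityMeasure I :=
  ⟨ENNReal.ofReal (1 - p) • Measure.dirac 0 + ENNReal.ofReal p • Measure.dirac 1, ⟨by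
    have := p.2.1; have := p.2.2
    simp only [Measure.coe_add, Measure.coe_smul, Pi.add_apply, Pi.smul_apply, measure_univ,
      smul_eq_mul, mul_one]
    rw [← ENNReal.ofReal_add (by linarith) (by linarith)]
    simp⟩⟩

theorem lintegral_bernoulliLaw (p : I) (g : I → ℝ≥0∞) :
    ∫⁻ x, g x ∂(bernoulliLaw p : Measure I)
      = ENNReal.ofReal (1 - p) * g 0 + ENNReal.ofReal p * g 1 := by
  simp [bernoulliLaw, lintegral_add_measure, lintegral_smul_measure]

theorem integral_bernoulliLaw (p : I) : ∫ x, (x : ℝ) ∂(bernoulliLaw p : Measure I) = p := by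
  rw [integral_eq_lintegral_of_nonneg_ae (Filter.Eventually.of_forall fun x : I => x.2.1)
    (by fun_prop), lintegral_bernoulliLaw]
  simp [p.2.1]

/-- The density of the Bernoulli law of parameter `q` with respect to that of parameter `b`. -/
def bernoulliDensity (b q : I) (x : I) : ℝ :=
  if x = 1 then (q : ℝ) / b else (1 - q) / (1 - b)

theorem measurable_bernoulliDensity (b q : I) : Measurable (bernoulliDensity b q) :=
  Measurable.ite (measurableSet_singleton 1) measurable_const measurable_const

theorem bernoulliDensity_pos {b q : I} (hb : 0 < (b : ℝ)) (hb' : (b : ℝ) < 1) (hq : 0 < (q : ℝ))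
    (hq' : (q : ℝ) < 1) (x : I) : 0 < bernoulliDensity b q x := by
  unfold bernoulliDensity
  split_ifs
  · positivity
  · exact div_pos (by linarith) (by linarith)

theorem bernoulliLaw_eq_withDensity {b q : I} (hb : 0 < (b : ℝ)) (hb' : (b : ℝ) < 1) :
    (bernoulliLaw q : Measure I)
      = (bernoulliLaw b : Measure I).withDensity
        fun x => ENNReal.ofReal (bernoulliDensity b q x) := by
  refine Measure.ext_of_lintegral _ fun g hg => ?_
  rw [lintegral_withDensity_eq_lintegral_mul _ (measurable_bernoulliDensity b q).ennreal_ofReal hg,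
    lintegral_bernoulliLaw, lintegral_bernoulliLaw]
  have h1 : (1 - b : ℝ) ≠ 0 := by linarith
  simp only [Pi.mul_apply, bernoulliDensity, zero_ne_one, if_false, if_true]
  rw [← mul_assoc, ← mul_assoc, ← ENNReal.ofReal_mul (by linarith), ← ENNReal.ofReal_mul hb.le,
    mul_div_cancel₀ _ h1, mul_div_cancel₀ _ hb.ne']

theorem lintegral_inv_bernoulliDensity {b q : I} (hb : 0 < (b : ℝ)) (hbq : (b : ℝ) ≤ q)
    (hq : (q : ℝ) ≤ 1 - b) :
    ∫⁻ x, ENNReal.ofReal (bernoulliDensity b q x)⁻¹ ∂(bernoulliLaw b : Measure I)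
      ≤ ENNReal.ofReal (1 + (q - b) ^ 2 / b ^ 2) := by
  have hq0 : 0 < (q : ℝ) := by linarith
  have hq1 : 0 < 1 - (q : ℝ) := by linarith
  rw [lintegral_bernoulliLaw]
  simp only [bernoulliDensity, zero_ne_one, if_false, if_true, inv_div]
  rw [← ENNReal.ofReal_mul (by linarith), ← ENNReal.ofReal_mul hb.le,
    ← ENNReal.ofReal_add (mul_nonneg (by linarith) (div_nonneg (by linarith) hq1.le))
      (by positivity)]
  refine ENNReal.ofReal_le_ofReal ?_
  have h1 : (1 - b : ℝ) * ((1 - b) / (1 - q)) + b * (b / q) = 1 + (q - b) ^ 2 / (q * (1 - q)) := by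
    field_simp
    ring
  rw [h1]
  have : (b : ℝ) ^ 2 ≤ q * (1 - q) := by nlinarith
  gcongr

/-- The instance with Bernoulli rewards in which arm `i` has mean `q` and all other arms have mean
`b`. -/
def spike {n : ℕ} (b q : I) (i : Fin n) : BanditInstance n :=
  fun j => if j = i then bernoulliLaw q else bernoulliLaw b

section spike

variable {n m : ℕ} {b q : I} (i : Fin n)

theorem mean_spike (j : Fin n) : (spike b q i).mean j = if j = i then (q : ℝ) else b := by
  unfold BanditInstance.mean spike
  split_ifs <;> exact integral_bernoulliLaw _

theorem bestMean_spike (hbq : (b : ℝ) ≤ q) : (spike b q i).bestMean = q := by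
  have : Nonempty (Fin n) := ⟨i⟩
  refine le_antisymm (ciSup_le fun j => ?_) ?_
  · rw [mean_spike]
    split_ifs
    exacts [le_rfl, hbq]
  · have := le_ciSup (Set.finite_range (spike b q i).mean).bddAbove i
    rwa [mean_spike, if_pos rfl] at this

theorem gap_spike (hbq : (b : ℝ) ≤ q) {j : Fin n} (hj : j ≠ i) :
    (spike b q i).gap j = q - b := by
  rw [BanditInstance.gap, bestMean_spike i hbq, mean_spike, if_neg hj]

theorem setGap_spike (hbq : (b : ℝ) ≤ q) {S : Finset (Fin n)} (hS : S.Nonempty) (hi : i ∉ S) :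
    (spike b q i).setGap S = q - b := by
  have : Nonempty S := hS.coe_sort
  have h : ∀ j : S, (spike b q i).mean j = b := fun j => by
    rw [mean_spike, if_neg fun h : j.1 = i => hi (h ▸ j.2)]
  rw [BanditInstance.setGap, bestMean_spike i hbq]
  simp only [h, ciSup_const]

namespace BARAlgorithm

variable (A : BARAlgorithm n m)

theorem le_expectedGap_spike (hm : 1 ≤ m) (hbq : (b : ℝ) ≤ q) (N : ℕ) :
    ENNReal.ofReal (q - b) * A.law (spike b q i) (A.dropEvent N i)
      ≤ A.expectedGap (spike b q i) := by
  rw [← lintegral_indicator_const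
    (A.measurableSet_of_info (A.measurableSet_info_dropEvent N i)) _]
  refine lintegral_mono fun ω => ?_
  by_cases h : ω ∈ A.dropEvent N i
  · rw [Set.indicator_of_mem h]
    have hne : A.sampleSize ω ≠ ⊤ := ne_top_of_le_ne_top (ENat.natCast_ne_top N) h.1
    have hS : (A.retained ω).Nonempty := by
      rw [← Finset.card_pos, retained, A.card_output]; omega
    simp only [hne, if_false, setGap_spike i hbq hS h.2, le_refl]
  · rw [Set.indicator_of_notMem h]
    exact zero_le

theorem le_regret_spike (hbq : (b : ℝ) ≤ q) (N : ℕ) :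
    ENNReal.ofReal ((q - b) * ((N + 1) / 2)) * A.law (spike b q i) (A.longEvent N i)
      ≤ A.regret (spike b q i) := by
  rw [← lintegral_indicator_const
    (A.measurableSet_of_info (A.measurableSet_info_longEvent N i)) _]
  refine lintegral_mono fun ω => ?_
  by_cases h : ω ∈ A.longEvent N i
  · rw [Set.indicator_of_mem h]
    have hsum := A.sum_armCount ω (N + 1)
    rw [← Finset.add_sum_erase _ _ (Finset.mem_univ i)] at hsum
    have hcount : N + 1 ≤ 2 * ∑ j ∈ Finset.univ.erase i, A.armCount ω (N + 1) j := by
      have := h.2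
      omega
    have hreal : ((N : ℝ) + 1) / 2
        ≤ ((∑ j ∈ Finset.univ.erase i, A.armCount ω (N + 1) j : ℕ) : ℝ) := by
      have : ((N + 1 : ℕ) : ℝ)
          ≤ ((2 * ∑ j ∈ Finset.univ.erase i, A.armCount ω (N + 1) j : ℕ) : ℝ) := by
        exact_mod_cast hcount
      push_cast at this ⊢
      linarith
    calc ENNReal.ofReal ((q - b) * ((N + 1) / 2))
        ≤ ENNReal.ofReal ((q - b)
            * ((∑ j ∈ Finset.univ.erase i, A.armCount ω (N + 1) j : ℕ) : ℝ)) :=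
          ENNReal.ofReal_le_ofReal (mul_le_mul_of_nonneg_left hreal (by linarith))
      _ = ∑ j ∈ Finset.univ.erase i, ENNReal.ofReal (q - b) * A.armCount ω (N + 1) j := by
          rw [ENNReal.ofReal_mul (by linarith), ENNReal.ofReal_natCast, Nat.cast_sum,
            Finset.mul_sum]
      _ ≤ ∑ j ∈ Finset.univ.erase i,
            ENNReal.ofReal ((spike b q i).gap j) * A.pullCount ω j := by
          refine Finset.sum_le_sum fun j hj => ?_
          rw [gap_spike i hbq (Finset.ne_of_mem_erase hj)]
          gcongr
          exact A.armCount_le_pullCount ω h.1 j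
      _ ≤ _ := Finset.sum_le_sum_of_subset (Finset.erase_subset _ _)
  · rw [Set.indicator_of_notMem h]
    exact zero_le

end BARAlgorithm

end spike

/-! ### The lower bound -/

theorem mul_measureReal_le_sum {Ω ι : Type*} [MeasurableSpace Ω] [Fintype ι] (μ : Measure Ω)
    [IsFiniteMeasure μ] {F : ι → Set Ω} {E : Set Ω} (hF : ∀ i, MeasurableSet (F i))
    (hE : MeasurableSet E) (c : ℝ)
    (h : ∀ ω, c * E.indicator 1 ω ≤ ∑ i, (F i).indicator (1 : Ω → ℝ) ω) :
    c * μ.real E ≤ ∑ i, μ.real (F i) := by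
  have hint : ∀ {B : Set Ω}, MeasurableSet B → Integrable (B.indicator (1 : Ω → ℝ)) μ :=
    fun hB => (integrable_const (1 : ℝ)).indicator hB
  simp only [← integral_indicator_one hE, ← integral_indicator_one (hF _)]
  rw [← integral_const_mul, ← integral_finsetSum _ fun i _ => hint (hF i)]
  exact integral_mono ((hint hE).const_mul c) (integrable_finsetSum _ fun i _ => hint (hF i)) h

namespace BARAlgorithm

variable {n m : ℕ} (A : BARAlgorithm n m)

theorem sum_arm_eq (ν : BanditInstance n) (t : ℕ) :
    ∑ i, (A.law ν).real {ω | A.arm ω t = i} = 1 := by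
  have h := sum_measureReal_preimage_singleton (μ := A.law ν) Finset.univ
    (f := fun ω => A.arm ω t) fun i _ => A.measurable_arm t (measurableSet_singleton i)
  simpa [Set.preimage] using h

/-- Each run that stops within `N` rounds drops exactly `n - m` arms. -/
theorem le_sum_dropEvent (ν : BanditInstance n) (hmn : m ≤ n) (N : ℕ) :
    ((n : ℝ) - m) * (A.law ν).real {ω | A.sampleSize ω ≤ N}
      ≤ ∑ i, (A.law ν).real (A.dropEvent N i) := by
  classical
  refine mul_measureReal_le_sum _ (fun i => A.measurableSet_of_info
    (A.measurableSet_info_dropEvent N i)) (A.measurableSet_of_info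
    (A.measurableSet_info_sampleSize_le N)) _ fun ω => ?_
  by_cases h : A.sampleSize ω ≤ N
  · have h1 : ∀ i, (A.dropEvent N i).indicator (1 : A.Outcome → ℝ) ω
        = if i ∈ (A.retained ω)ᶜ then 1 else 0 := fun i => by
      simp [Set.indicator_apply, dropEvent, h]
    simp only [h1, Finset.sum_ite_mem, Finset.univ_inter, Finset.sum_const, nsmul_eq_mul, mul_one]
    rw [Finset.card_compl, Fintype.card_fin, retained, A.card_output, Nat.cast_sub hmn]
    simp [h]
  · rw [Set.indicator_of_notMem (by exact h), mul_zero]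
    exact Finset.sum_nonneg fun i _ => Set.indicator_nonneg (fun _ _ => zero_le_one) _

/-- At most one arm can take more than half of the rounds. -/
theorem le_sum_longEvent (ν : BanditInstance n) (N : ℕ) :
    ((n : ℝ) - 1) * (A.law ν).real {ω | A.sampleSize ω ≤ N}ᶜ
      ≤ ∑ i, (A.law ν).real (A.longEvent N i) := by
  classical
  refine mul_measureReal_le_sum _ (fun i => A.measurableSet_of_info
    (A.measurableSet_info_longEvent N i)) (A.measurableSet_of_info
    (A.measurableSet_info_sampleSize_le N)).compl _ fun ω => ?_
  by_cases h : A.sampleSize ω ≤ N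
  · rw [Set.indicator_of_notMem (by simpa using h), mul_zero]
    exact Finset.sum_nonneg fun i _ => Set.indicator_nonneg (fun _ _ => zero_le_one) _
  · have h1 : ∀ i, (A.longEvent N i).indicator (1 : A.Outcome → ℝ) ω
        = 1 - if ¬ 2 * A.armCount ω (N + 1) i ≤ N + 1 then 1 else 0 := fun i => by
      by_cases h2 : 2 * A.armCount ω (N + 1) i ≤ N + 1 <;>
        simp [longEvent, not_le.1 h, h2]
    have h2 :
        (Finset.univ.filter fun i : Fin n => ¬ 2 * A.armCount ω (N + 1) i ≤ N + 1).card ≤ 1 := by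
      refine Finset.card_le_one.2 fun i hi j hj => ?_
      by_contra hij
      simp only [Finset.mem_filter, Finset.mem_univ, true_and, not_le] at hi hj
      have hle : ∑ l ∈ ({i, j} : Finset (Fin n)), A.armCount ω (N + 1) l ≤ N + 1 :=
        (Finset.sum_le_sum_of_subset (Finset.subset_univ _)).trans_eq (A.sum_armCount ω (N + 1))
      rw [Finset.sum_pair hij] at hle
      omega
    simp only [h1, Finset.sum_sub_distrib, Finset.sum_boole, Finset.sum_const, Finset.card_univ,
      Fintype.card_fin, nsmul_eq_mul, mul_one]
    rw [Set.indicator_of_mem (by simpa using h), Pi.one_apply, mul_one]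
    have : ((Finset.univ.filter
        fun i : Fin n => ¬ 2 * A.armCount ω (N + 1) i ≤ N + 1).card : ℝ) ≤ 1 := by
      exact_mod_cast h2
    linarith

theorem measureReal_le_spike {b q : I} (hb : 0 < (b : ℝ)) (hbq : (b : ℝ) ≤ q)
    (hq : (q : ℝ) ≤ 1 - b) {N : ℕ} (i : Fin n) {E : Set A.Outcome}
    (hE : MeasurableSet[A.info N] E) {a : ℝ} (ha : 0 ≤ a) :
    a * (A.law fun _ => bernoulliLaw b).real E
      ≤ (Real.exp a - 1) * (A.law (spike b q i)).real E
        + (q - b) ^ 2 / b ^ 2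
          * ∑ t ∈ Finset.range N, (A.law fun _ => bernoulliLaw b).real {ω | A.arm ω t = i} := by
  refine A.mul_measureReal_le_of_density (measurable_bernoulliDensity b q)
    (bernoulliDensity_pos hb (by linarith) (by linarith) (by linarith)) ?_ ?_ (by positivity)
    (lintegral_inv_bernoulliDensity hb hbq hq) hE ha
  · rw [spike, if_pos rfl]
    exact bernoulliLaw_eq_withDensity hb (by linarith)
  · intro j hj
    rw [spike, if_neg hj]

/-- The comparison of the flat instance with all spiked instances at once. The numbers of pulls of
the arms add up to `N`, so the total cost is that of `N` pulls of a single arm. -/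
theorem sum_mul_measureReal_le_spike {b q : I} (hb : 0 < (b : ℝ)) (hbq : (b : ℝ) ≤ q)
    (hq : (q : ℝ) ≤ 1 - b) {N : ℕ} {E : Fin n → Set A.Outcome}
    (hE : ∀ i, MeasurableSet[A.info N] (E i)) {a : ℝ} (ha : 0 ≤ a) :
    a * ∑ i, (A.law fun _ => bernoulliLaw b).real (E i)
      ≤ (Real.exp a - 1) * ∑ i, (A.law (spike b q i)).real (E i)
        + (q - b) ^ 2 / b ^ 2 * N := by
  have h := Finset.sum_le_sum fun i (_ : i ∈ Finset.univ) =>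
    A.measureReal_le_spike hb hbq hq i (hE i) ha
  rw [Finset.sum_add_distrib, ← Finset.mul_sum, ← Finset.mul_sum, ← Finset.mul_sum,
    Finset.sum_comm] at h
  simpa only [sum_arm_eq, Finset.sum_const, Finset.card_range, nsmul_eq_mul, mul_one] using h

set_option maxHeartbeats 400000 in
theorem le_regretComplexity_of_isRBAR {β : ℝ} (hβ : 0 < β) (hβ1 : β < 1) {r : ℝ} (hm : 1 ≤ m)
    (hmn : m < n) (hr : 0 < r) (hrk : r ≤ (1 - β) * (((n : ℝ) - m) / n)) (hA : A.IsRBAR r) :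
    ENNReal.ofReal (β ^ 5 / 131072 * (((n : ℝ) - m) ^ 2 / (n * r))) ≤ A.regretComplexity := by
  have hn2 : (2 : ℝ) ≤ n := by exact_mod_cast (by omega : 2 ≤ n)
  have hn0 : (0 : ℝ) < n := by linarith
  have hm1 : (1 : ℝ) ≤ m := by exact_mod_cast hm
  set k : ℝ := (n : ℝ) - m with hk
  have hk1 : 1 ≤ k := by
    have : ((m + 1 : ℕ) : ℝ) ≤ n := by exact_mod_cast hmn
    push_cast at this; linarith
  have hkn : k ≤ n := by linarith
  have hk0 : 0 < k := by linarith
  have hβ2 : 0 < 1 - β / 2 := by linarith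
  have hβ2' : 2 - β ≠ 0 := by linarith
  set Δ : ℝ := n * r / (k * (1 - β / 2)) with hΔ
  have hΔ0 : 0 < Δ := by positivity
  have hrn : n * r ≤ (1 - β) * k := by
    calc n * r ≤ n * ((1 - β) * (k / n)) := by gcongr
      _ = (1 - β) * k := by field_simp
  have hΔ1 : Δ ≤ 1 - β / 2 := by
    rw [hΔ, div_le_iff₀ (by positivity)]
    nlinarith [mul_pos hk0 (sq_pos_of_pos hβ)]
  -- the offset `β / 4` keeps both means away from `0` and `1`, where the chi-square cost blows up
  let b : I := ⟨β / 4, by linarith, by linarith⟩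
  let q : I := ⟨β / 4 + Δ, by linarith, by linarith⟩
  have hb : 0 < (b : ℝ) := by change 0 < β / 4; linarith
  have hbq : (b : ℝ) ≤ q := by change β / 4 ≤ β / 4 + Δ; linarith
  have hq : (q : ℝ) ≤ 1 - b := by change β / 4 + Δ ≤ 1 - β / 4; linarith
  have hqb : (q : ℝ) - b = Δ := by change β / 4 + Δ - β / 4 = Δ; ring
  have hbv : (b : ℝ) = β / 4 := rfl
  -- with this `N`, the term `N * (Δ / b) ^ 2` of the comparison is at most `β ^ 2 / 32 * k`
  set N : ℕ := ⌊β ^ 4 / 512 * k / Δ ^ 2⌋₊ with hN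
  have hNle : Δ ^ 2 * N ≤ β ^ 4 / 512 * k := by
    have : (N : ℝ) ≤ β ^ 4 / 512 * k / Δ ^ 2 := Nat.floor_le (by positivity)
    rwa [le_div_iff₀ (by positivity), mul_comm] at this
  have hNlt : β ^ 4 / 512 * k / Δ ^ 2 ≤ N + 1 := (Nat.lt_floor_add_one _).le
  have hdiv : ((q : ℝ) - b) ^ 2 / (b : ℝ) ^ 2 * N ≤ β ^ 2 / 32 * k := by
    rw [hqb, hbv, div_mul_eq_mul_div, div_le_iff₀ (by positivity)]
    calc Δ ^ 2 * N ≤ β ^ 4 / 512 * k := hNle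
      _ = β ^ 2 / 32 * k * (β / 4) ^ 2 := by ring
  set x : ℝ := (A.law fun _ => bernoulliLaw b).real {ω | A.sampleSize ω ≤ N} with hx
  -- an `r`-BAR algorithm rarely drops the good arm of a spiked instance
  have hdrop : ∀ i, (A.law (spike b q i)).real (A.dropEvent N i) ≤ k * (1 - β / 2) / n := by
    intro i
    have h1 := (A.le_expectedGap_spike i hm hbq N).trans (hA _).le
    rw [hqb, ← ofReal_measureReal, ← ENNReal.ofReal_mul hΔ0.le,
      ENNReal.ofReal_le_ofReal_iff hr.le] at h1
    rw [le_div_iff₀ hn0]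
    refine le_of_mul_le_mul_left ?_ hr
    calc r * ((A.law (spike b q i)).real (A.dropEvent N i) * n)
        = (Δ * (A.law (spike b q i)).real (A.dropEvent N i)) * (k * (1 - β / 2)) := by
          rw [hΔ]; field_simp
      _ ≤ r * (k * (1 - β / 2)) := by gcongr
  have hdropsum : ∑ i, (A.law (spike b q i)).real (A.dropEvent N i) ≤ k * (1 - β / 2) := by
    calc ∑ i, (A.law (spike b q i)).real (A.dropEvent N i)
        ≤ ∑ _i : Fin n, k * (1 - β / 2) / n := Finset.sum_le_sum fun i _ => hdrop i
      _ = k * (1 - β / 2) := by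
          rw [Finset.sum_const, Finset.card_univ, Fintype.card_fin, nsmul_eq_mul]; field_simp
  -- hence on the flat instance it does not stop too early
  have hx1 : x ≤ 1 - β / 8 := by
    have h1 := A.sum_mul_measureReal_le_spike hb hbq hq (N := N)
      (fun i => A.measurableSet_info_dropEvent N i) (a := β / 4) (by linarith)
    have h2 := A.le_sum_dropEvent (fun _ => bernoulliLaw b) hmn.le N
    have hexp : Real.exp (β / 4) - 1 ≤ β / 4 * (1 + β / 4) := by
      have := Real.abs_exp_sub_one_sub_id_le (x := β / 4) (by rw [abs_of_pos] <;> linarith)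
      have := (abs_le.1 this).2
      linarith
    have h3 : (Real.exp (β / 4) - 1) * ∑ i, (A.law (spike b q i)).real (A.dropEvent N i)
        ≤ β / 4 * (1 + β / 4) * (k * (1 - β / 2)) :=
      mul_le_mul hexp hdropsum (Finset.sum_nonneg fun i _ => measureReal_nonneg) (by positivity)
    have h4 : β / 4 * (k * x) ≤ β / 4 * (1 + β / 4) * (k * (1 - β / 2)) + β ^ 2 / 32 * k := by
      have : β / 4 * (k * x) ≤ β / 4 * ∑ i, (A.law fun _ => bernoulliLaw b).real
        (A.dropEvent N i) := mul_le_mul_of_nonneg_left h2 (by linarith)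
      linarith
    have h5 : β / 4 * k * x ≤ β / 4 * k * (1 - β / 8) := by
      have : β / 4 * (1 + β / 4) * (k * (1 - β / 2)) + β ^ 2 / 32 * k
          = β / 4 * k * (1 - β / 8) - β ^ 3 / 32 * k := by ring
      have : 0 ≤ β ^ 3 / 32 * k := by positivity
      linarith
    exact le_of_mul_le_mul_left h5 (by positivity)
  -- so on some spiked instance it runs long while missing the good arm
  obtain ⟨i, hi⟩ : ∃ i, β / 64 ≤ (A.law (spike b q i)).real (A.longEvent N i) := by
    have h1 := A.sum_mul_measureReal_le_spike hb hbq hq (N := N)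
      (fun i => A.measurableSet_info_longEvent N i) (a := 1) zero_le_one
    have h2 := A.le_sum_longEvent (fun _ => bernoulliLaw b) N
    rw [probReal_compl_eq_one_sub (A.measurableSet_of_info
      (A.measurableSet_info_sampleSize_le N)), ← hx] at h2
    have h3 : n / 2 * (β / 8) ≤ ((n : ℝ) - 1) * (1 - x) :=
      mul_le_mul (by linarith) (by linarith) (by linarith) (by linarith)
    have h4 : (Real.exp 1 - 1) * ∑ i, (A.law (spike b q i)).real (A.longEvent N i)
        ≤ 2 * ∑ i, (A.law (spike b q i)).real (A.longEvent N i) :=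
      mul_le_mul_of_nonneg_right (by linarith [Real.exp_one_lt_d9])
        (Finset.sum_nonneg fun i _ => measureReal_nonneg)
    have h5 : β ^ 2 / 32 * k ≤ β / 32 * n := by
      have : β ^ 2 ≤ β := pow_le_of_le_one hβ.le hβ1.le two_ne_zero
      gcongr
    have h6 : ∑ _i : Fin n, β / 64 ≤ ∑ i, (A.law (spike b q i)).real (A.longEvent N i) := by
      rw [Finset.sum_const, Finset.card_univ, Fintype.card_fin, nsmul_eq_mul]
      linarith
    have : Nonempty (Fin n) := ⟨⟨0, by omega⟩⟩
    obtain ⟨i, -, hi⟩ := Finset.exists_le_of_sum_le Finset.univ_nonempty h6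
    exact ⟨i, hi⟩
  refine le_trans ?_ ((A.le_regret_spike i hbq N).trans (le_iSup A.regret (spike b q i)))
  rw [hqb, ← ofReal_measureReal, ← ENNReal.ofReal_mul (by positivity)]
  refine ENNReal.ofReal_le_ofReal ?_
  calc β ^ 5 / 131072 * (k ^ 2 / (n * r))
      = β ^ 5 / 65536 * (k ^ 2 / (n * r)) * (1 / 2) := by ring
    _ ≤ β ^ 5 / 65536 * (k ^ 2 / (n * r)) * (1 - β / 2) :=
        mul_le_mul_of_nonneg_left (by linarith) (by positivity)
    _ = Δ * ((β ^ 4 / 512 * k / Δ ^ 2) / 2) * (β / 64) := by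
        rw [hΔ]; field_simp; norm_num
    _ ≤ Δ * ((N + 1) / 2) * (A.law (spike b q i)).real (A.longEvent N i) := by gcongr

end BARAlgorithm

/-! ### The Tsallis forecaster -/

namespace Tsallis

variable {ι : Type*} {η : ℝ} {B : Finset ι} {L : ι → ℝ}

theorem exists_normalizer (hη : 0 < η) (hB : B.Nonempty) (L : ι → ℝ) :
    ∃ l : ℝ, (∀ i ∈ B, l < L i) ∧ ∑ i ∈ B, ((η * (L i - l))⁻¹) ^ 2 = 1 := by
  obtain ⟨j, hj, hmin⟩ := B.exists_min_image L hB
  have hc : (1 : ℝ) ≤ B.card := by exact_mod_cast hB.card_pos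
  have hs : 1 ≤ √(B.card : ℝ) := Real.one_le_sqrt.2 hc
  have hlt : ∀ l ∈ Set.Icc (L j - √B.card / η) (L j - 1 / η), ∀ i ∈ B, l < L i := by
    intro l hl i hi
    have : 0 < 1 / η := by positivity
    linarith [hl.2, hmin i hi]
  have hcont : ContinuousOn (fun l => ∑ i ∈ B, ((η * (L i - l))⁻¹) ^ 2)
      (Set.Icc (L j - √B.card / η) (L j - 1 / η)) := by
    refine continuousOn_finsetSum _ fun i hi => ContinuousOn.pow (ContinuousOn.inv₀ (by fun_prop)
      fun l hl => ?_) 2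
    have := hlt l hl i hi
    exact (mul_pos hη (by linarith)).ne'
  have hle : L j - √B.card / η ≤ L j - 1 / η := by gcongr
  have hmem : (1 : ℝ) ∈ Set.Icc (∑ i ∈ B, ((η * (L i - (L j - √B.card / η)))⁻¹) ^ 2)
      (∑ i ∈ B, ((η * (L i - (L j - 1 / η)))⁻¹) ^ 2) := by
    constructor
    · calc ∑ i ∈ B, ((η * (L i - (L j - √B.card / η)))⁻¹) ^ 2
          ≤ ∑ _i ∈ B, ((√(B.card : ℝ))⁻¹) ^ 2 := by
            refine Finset.sum_le_sum fun i hi => ?_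
            have h1 : √(B.card : ℝ) ≤ η * (L i - (L j - √B.card / η)) := by
              have : η * (√(B.card : ℝ) / η) = √(B.card : ℝ) := by field_simp
              nlinarith [hmin i hi]
            have h2 : 0 < √(B.card : ℝ) := by linarith
            have h3 := inv_anti₀ h2 h1
            have h4 : 0 ≤ (η * (L i - (L j - √B.card / η)))⁻¹ := inv_nonneg.2 (h2.le.trans h1)
            gcongr
        _ = 1 := by
            rw [Finset.sum_const, nsmul_eq_mul, inv_pow, Real.sq_sqrt (by linarith)]
            field_simp
    · have h1 : ((η * (L j - (L j - 1 / η)))⁻¹) ^ 2 = 1 := by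
        field_simp
        simp
      refine h1.ge.trans ?_
      exact Finset.single_le_sum (f := fun i => ((η * (L i - (L j - 1 / η)))⁻¹) ^ 2)
        (fun i _ => by positivity) hj
  obtain ⟨l, hl, h⟩ := intermediate_value_Icc hle hcont hmem
  exact ⟨l, hlt l hl, h⟩

open Classical in
/-- The Lagrange multiplier of the `1/2`-Tsallis regularized leader on the arms of `B`, at the
cumulative losses `L`: the number `l` below these losses for which the weights
`(η * (L i - l))⁻²` sum to `1`. -/
def normalizer (η : ℝ) (B : Finset ι) (L : ι → ℝ) : ℝ :=
  if h : ∃ l : ℝ, (∀ i ∈ B, l < L i) ∧ ∑ i ∈ B, ((η * (L i - l))⁻¹) ^ 2 = 1 then h.choose else 0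

theorem normalizer_lt (hη : 0 < η) {i : ι} (hi : i ∈ B) : normalizer η B L < L i := by
  have h := exists_normalizer hη ⟨i, hi⟩ L
  rw [normalizer, dif_pos h]
  exact h.choose_spec.1 i hi

theorem sum_normalizer (hη : 0 < η) (hB : B.Nonempty) (L : ι → ℝ) :
    ∑ i ∈ B, ((η * (L i - normalizer η B L))⁻¹) ^ 2 = 1 := by
  have h := exists_normalizer hη hB L
  rw [normalizer, dif_pos h]
  exact h.choose_spec.2

theorem normalizer_lt_iff (hη : 0 < η) (hB : B.Nonempty) (L : ι → ℝ) (c : ℝ) :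
    normalizer η B L < c ↔ (∃ i ∈ B, L i ≤ c) ∨ 1 < ∑ i ∈ B, ((η * (L i - c))⁻¹) ^ 2 := by
  have hpos : ∀ i ∈ B, 0 < L i - normalizer η B L := fun i hi => sub_pos.2 (normalizer_lt hη hi)
  constructor
  · intro h
    by_contra! hne
    refine absurd hne.2 (not_le.2 ?_)
    rw [← sum_normalizer hη hB L]
    refine Finset.sum_lt_sum_of_nonempty hB fun i hi => ?_
    have h1 : 0 < η * (L i - c) := mul_pos hη (sub_pos.2 (hne.1 i hi))
    have h3 : (η * (L i - normalizer η B L))⁻¹ < (η * (L i - c))⁻¹ :=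
      inv_strictAnti₀ h1 (by gcongr)
    have h2 : 0 ≤ (η * (L i - normalizer η B L))⁻¹ := inv_nonneg.2 (mul_pos hη (hpos i hi)).le
    gcongr
  · intro h
    by_contra! hc
    have hlt : ∀ i ∈ B, c < L i := fun i hi => hc.trans_lt (normalizer_lt hη hi)
    rcases h with ⟨i, hi, hi'⟩ | h
    · exact absurd (hlt i hi) (not_lt.2 hi')
    · refine absurd h (not_lt.2 ?_)
      rw [← sum_normalizer hη hB L]
      refine Finset.sum_le_sum fun i hi => ?_
      have h3 : (η * (L i - c))⁻¹ ≤ (η * (L i - normalizer η B L))⁻¹ :=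
        inv_anti₀ (mul_pos hη (hpos i hi)) (by gcongr)
      have h2 : 0 ≤ (η * (L i - c))⁻¹ := inv_nonneg.2 (mul_pos hη (sub_pos.2 (hlt i hi))).le
      gcongr

theorem measurable_normalizer (hη : 0 < η) (hB : B.Nonempty) : Measurable (normalizer η B) := by
  refine measurable_of_Iio fun c => ?_
  have : normalizer η B ⁻¹' Set.Iio c = (⋃ i ∈ B, {L | L i ≤ c})
      ∪ {L | 1 < ∑ i ∈ B, ((η * (L i - c))⁻¹) ^ 2} := by
    ext L
    simp [normalizer_lt_iff hη hB]
  rw [this]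
  refine (B.measurableSet_biUnion fun i _ => ?_).union ?_
  · exact measurableSet_le (measurable_pi_apply i) measurable_const
  · exact measurableSet_lt measurable_const (by fun_prop)

open Classical in
/-- The probability that the forecaster gives to arm `i`. -/
def prob (η : ℝ) (B : Finset ι) (L : ι → ℝ) (i : ι) : ℝ :=
  if i ∈ B then ((η * (L i - normalizer η B L))⁻¹) ^ 2 else 0

theorem prob_nonneg (i : ι) : 0 ≤ prob η B L i := by
  unfold prob
  split_ifs <;> positivity

theorem prob_pos (hη : 0 < η) {i : ι} (hi : i ∈ B) : 0 < prob η B L i := by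
  rw [prob, if_pos hi]
  have : 0 < η * (L i - normalizer η B L) := mul_pos hη (sub_pos.2 (normalizer_lt hη hi))
  positivity

theorem prob_of_notMem {i : ι} (hi : i ∉ B) : prob η B L i = 0 := if_neg hi

theorem sum_prob_of_mem (hη : 0 < η) (hB : B.Nonempty) : ∑ i ∈ B, prob η B L i = 1 := by
  rw [← sum_normalizer hη hB L]
  exact Finset.sum_congr rfl fun i hi => if_pos hi

theorem sum_prob [Fintype ι] (hη : 0 < η) (hB : B.Nonempty) : ∑ i, prob η B L i = 1 := by
  rw [← sum_prob_of_mem hη hB]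
  exact (Finset.sum_subset (Finset.subset_univ B) fun i _ hi => prob_of_notMem hi).symm

theorem measurable_prob (hη : 0 < η) (hB : B.Nonempty) (i : ι) :
    Measurable fun L => prob η B L i := by
  unfold prob
  split_ifs
  · have := measurable_normalizer (ι := ι) hη hB
    fun_prop
  · exact measurable_const

theorem sum_sqrt_prob_le [Fintype ι] (hη : 0 < η) (hB : B.Nonempty) :
    ∑ i, √(prob η B L i) ≤ √B.card := by
  have h1 : ∑ i, √(prob η B L i) = ∑ i ∈ B, √(prob η B L i) :=
    (Finset.sum_subset (Finset.subset_univ B) fun i _ hi => by simp [prob_of_notMem hi]).symm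
  rw [h1]
  refine Real.le_sqrt_of_sq_le ?_
  refine sq_sum_le_card_mul_sum_sq.trans (le_of_eq ?_)
  simp only [Real.sq_sqrt (prob_nonneg _), sum_prob_of_mem hη hB, mul_one]

/-- The dual objective of the regularized leader: for fixed losses `L` it is concave in `l`, with
maximizer `normalizer η B L`. -/
def dual (η : ℝ) (B : Finset ι) (L : ι → ℝ) (l : ℝ) : ℝ :=
  l - ∑ i ∈ B, (η ^ 2 * (L i - l))⁻¹

/-- The potential of the forecaster, a smooth lower bound for the smallest cumulative loss. -/
def potential (η : ℝ) (B : Finset ι) (L : ι → ℝ) : ℝ := dual η B L (normalizer η B L)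

theorem potential_le (hη : 0 < η) {c : ι} (hc : c ∈ B) : potential η B L ≤ L c := by
  have h1 := normalizer_lt (L := L) hη hc
  have h2 : 0 ≤ ∑ i ∈ B, (η ^ 2 * (L i - normalizer η B L))⁻¹ :=
    Finset.sum_nonneg fun i hi => by
      have := sub_pos.2 (normalizer_lt (L := L) hη hi)
      positivity
  unfold potential dual
  linarith

theorem dual_le_potential (hη : 0 < η) (hB : B.Nonempty) {l : ℝ} (hl : ∀ i ∈ B, l < L i) :
    dual η B L l ≤ potential η B L := by
  set u := normalizer η B L with hu
  have hterm : ∀ i ∈ B, (η ^ 2 * (L i - u))⁻¹ - (u - l) * ((η * (L i - u))⁻¹) ^ 2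
      ≤ (η ^ 2 * (L i - l))⁻¹ := by
    intro i hi
    have ha : 0 < L i - u := sub_pos.2 (normalizer_lt hη hi)
    have hb : 0 < L i - l := sub_pos.2 (hl i hi)
    have key : (η ^ 2 * (L i - l))⁻¹ - ((η ^ 2 * (L i - u))⁻¹ - (u - l) * ((η * (L i - u))⁻¹) ^ 2)
        = (u - l) ^ 2 / (η ^ 2 * (L i - u) ^ 2 * (L i - l)) := by
      field_simp
      ring
    have : 0 ≤ (u - l) ^ 2 / (η ^ 2 * (L i - u) ^ 2 * (L i - l)) := by positivity
    linarith
  have hsum := Finset.sum_le_sum hterm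
  rw [Finset.sum_sub_distrib, ← Finset.mul_sum, sum_normalizer hη hB L] at hsum
  unfold potential dual
  linarith

theorem le_potential_zero (hη : 0 < η) (hB : B.Nonempty) :
    -(2 * √B.card / η) ≤ potential η B (0 : ι → ℝ) := by
  have hc : (0 : ℝ) < B.card := by exact_mod_cast hB.card_pos
  have hs : 0 < √(B.card : ℝ) := Real.sqrt_pos.2 hc
  have h := dual_le_potential (L := 0) hη hB (l := -(√B.card / η)) fun i _ => by
    rw [Pi.zero_apply]
    exact neg_lt_zero.2 (by positivity)
  refine le_trans (le_of_eq ?_) h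
  have h2 : √(B.card : ℝ) * √(B.card : ℝ) = B.card := Real.mul_self_sqrt hc.le
  simp only [dual, Pi.zero_apply, zero_sub, neg_neg, Finset.sum_const, nsmul_eq_mul]
  have h3 : (B.card : ℝ) * (η ^ 2 * (√(B.card : ℝ) / η))⁻¹ = √(B.card : ℝ) / η := by
    nth_rewrite 1 [← h2]
    field_simp
  rw [h3]
  ring

/-- One round of importance-weighted updating moves the potential up by at least the observed
loss, up to the variance term `η / √p`. -/
theorem potential_add_le [DecidableEq ι] (hη : 0 < η) {i : ι} (hi : i ∈ B) {x : ℝ}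
    (hx0 : 0 ≤ x) (hx1 : x ≤ 1) :
    potential η B L + x ≤ potential η B (L + Pi.single i (x / prob η B L i))
      + η / √(prob η B L i) := by
  set u := normalizer η B L with hu
  set p := prob η B L i with hp
  have hp0 : 0 < p := prob_pos hη hi
  have ha : 0 < L i - u := sub_pos.2 (normalizer_lt hη hi)
  set a := L i - u with haa
  have hpa : p = ((η * a)⁻¹) ^ 2 := by rw [hp, prob, if_pos hi]
  have hsq : √p = (η * a)⁻¹ := by rw [hpa]; exact Real.sqrt_sq (by positivity)
  have hz : 0 ≤ x / p := by positivity
  have hmax := dual_le_potential (L := L + Pi.single i (x / p)) hη ⟨i, hi⟩ (l := u) fun j hj => by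
    have h1 := normalizer_lt (L := L) hη hj
    have h2 : 0 ≤ (Pi.single i (x / p) : ι → ℝ) j := by
      by_cases hji : j = i
      · subst hji; simpa using hz
      · simp [hji]
    rw [Pi.add_apply]
    linarith
  have hdiff : dual η B (L + Pi.single i (x / p)) u - potential η B L
      = (η ^ 2 * a)⁻¹ - (η ^ 2 * (a + x / p))⁻¹ := by
    unfold potential dual
    rw [← Finset.add_sum_erase _ _ hi, ← Finset.add_sum_erase B (fun j => (η ^ 2 * (L j
      - normalizer η B L))⁻¹) hi]
    have : ∑ j ∈ B.erase i, (η ^ 2 * ((L + Pi.single i (x / p) : ι → ℝ) j - u))⁻¹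
        = ∑ j ∈ B.erase i, (η ^ 2 * (L j - normalizer η B L))⁻¹ :=
      Finset.sum_congr rfl fun j hj => by simp [Finset.ne_of_mem_erase hj, hu]
    rw [this]
    simp only [Pi.add_apply, Pi.single_eq_same, ← hu, haa]
    ring
  have hterm : x - η / √p ≤ (η ^ 2 * a)⁻¹ - (η ^ 2 * (a + x / p))⁻¹ := by
    have hxp : x / p = x * (η * a) ^ 2 := by rw [hpa]; field_simp
    rw [hsq, hxp]
    have e1 : (η ^ 2 * a)⁻¹ - (η ^ 2 * (a + x * (η * a) ^ 2))⁻¹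
        = x / (1 + x * η ^ 2 * a) := by
      field_simp
      ring
    rw [e1, div_inv_eq_mul, le_div_iff₀ (by positivity)]
    -- the difference of the two sides is a sum of nonnegative terms because `x ≤ 1`
    have h1 : x ^ 2 * (η ^ 2 * a) ≤ 1 * (η ^ 2 * a) := by
      gcongr
      nlinarith
    have h2 : 0 ≤ η * (η * a) * (x * η ^ 2 * a) := by positivity
    nlinarith
  linarith

/-- The pathwise regret bound of the forecaster. Runs that pull an arm outside `B`, which have
probability zero, are covered by the convention `0⁻¹ = ⊤` in the last sum. -/
theorem sum_loss_le [DecidableEq ι] (hη : 0 < η) {L : ℕ → ι → ℝ} {a : ℕ → ι} {x : ℕ → ℝ} {T : ℕ}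
    (h0 : L 0 = 0) (hx0 : ∀ t, 0 ≤ x t) (hx1 : ∀ t, x t ≤ 1)
    (hstep : ∀ t < T, L (t + 1) = L t + Pi.single (a t) (x t / prob η B (L t) (a t)))
    {c : ι} (hc : c ∈ B) :
    ∑ t ∈ Finset.range T, ENNReal.ofReal (x t)
      ≤ ∑ t ∈ Finset.range T,
          (if a t = c then ENNReal.ofReal (x t / prob η B (L t) c) else 0)
        + ENNReal.ofReal (2 * √B.card / η)
        + ∑ t ∈ Finset.range T,
          ENNReal.ofReal η * (ENNReal.ofReal √(prob η B (L t) (a t)))⁻¹ := by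
  by_cases hall : ∀ t < T, a t ∈ B
  · have hpot : ∀ s ≤ T, potential η B (L 0) + ∑ t ∈ Finset.range s, x t
        ≤ potential η B (L s) + ∑ t ∈ Finset.range s, η / √(prob η B (L t) (a t)) := by
      intro s
      induction s with
      | zero => intro _; simp
      | succ s ih =>
        intro hs
        have h1 := ih (by omega)
        have h2 := potential_add_le (L := L s) hη (hall s hs) (hx0 s) (hx1 s)
        rw [← hstep s hs] at h2
        rw [Finset.sum_range_succ, Finset.sum_range_succ]
        linarith
    have hL : ∀ s ≤ T, L s c
        = ∑ t ∈ Finset.range s, if a t = c then x t / prob η B (L t) c else 0 := by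
      intro s
      induction s with
      | zero => intro _; simp [h0]
      | succ s ih =>
        intro hs
        rw [Finset.sum_range_succ, ← ih (by omega), hstep s hs, Pi.add_apply]
        by_cases h : a s = c
        · simp [h]
        · simp [h]
    have hp : ∀ t ∈ Finset.range T, 0 < √(prob η B (L t) (a t)) := fun t ht =>
      Real.sqrt_pos.2 (prob_pos hη (hall t (Finset.mem_range.1 ht)))
    have e1 : ∑ t ∈ Finset.range T,
          (if a t = c then ENNReal.ofReal (x t / prob η B (L t) c) else 0)
        = ENNReal.ofReal (L T c) := by
      rw [hL T le_rfl, ENNReal.ofReal_sum_of_nonneg fun t _ => by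
        split_ifs
        exacts [div_nonneg (hx0 t) (prob_nonneg c), le_rfl]]
      exact Finset.sum_congr rfl fun t _ => by split_ifs <;> simp
    have e2 : ∑ t ∈ Finset.range T,
          ENNReal.ofReal η * (ENNReal.ofReal √(prob η B (L t) (a t)))⁻¹
        = ENNReal.ofReal (∑ t ∈ Finset.range T, η / √(prob η B (L t) (a t))) := by
      rw [ENNReal.ofReal_sum_of_nonneg fun t _ => by positivity]
      refine Finset.sum_congr rfl fun t ht => ?_
      rw [← ENNReal.ofReal_inv_of_pos (hp t ht), ← ENNReal.ofReal_mul hη.le, div_eq_mul_inv]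
    have hLc : 0 ≤ L T c := by
      rw [hL T le_rfl]
      exact Finset.sum_nonneg fun t _ => by
        split_ifs
        exacts [div_nonneg (hx0 t) (prob_nonneg c), le_rfl]
    rw [e1, e2, ← ENNReal.ofReal_sum_of_nonneg fun t _ => hx0 t,
      ← ENNReal.ofReal_add hLc (by positivity),
      ← ENNReal.ofReal_add (by positivity) (Finset.sum_nonneg fun t _ => by positivity)]
    refine ENNReal.ofReal_le_ofReal ?_
    have h1 := hpot T le_rfl
    have h2 := le_potential_zero hη ⟨c, hc⟩ (B := B)
    have h3 := potential_le (L := L T) hη hc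
    rw [h0] at h1
    linarith
  · push Not at hall
    obtain ⟨t, ht, hta⟩ := hall
    have htop : ∑ t ∈ Finset.range T,
        ENNReal.ofReal η * (ENNReal.ofReal √(prob η B (L t) (a t)))⁻¹ = ⊤ := by
      refine ENNReal.sum_eq_top.2 ⟨t, Finset.mem_range.2 ht, ?_⟩
      rw [prob_of_notMem hta]
      simp [ENNReal.mul_top, hη]
    rw [htop, add_top]
    exact le_top

end Tsallis

/-! ### Algorithms given by sampling probabilities -/

/-- Sampling from a measurable family of distributions on `Fin n` by means of one uniform random
number. -/
theorem exists_sampler {X : Type*} [MeasurableSpace X] {n : ℕ} [NeZero n] {p : X → Fin n → ℝ≥0∞}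
    (hp : ∀ i, Measurable fun x => p x i) (hsum : ∀ x, ∑ i, p x i = 1) :
    ∃ f : X → I → Fin n, Measurable (Function.uncurry f) ∧
      ∀ x (g : Fin n → ℝ≥0∞), ∫⁻ v, g (f x v) = ∑ i, p x i * g i := by
  let κ : ProbabilityTheory.Kernel X (Fin n) :=
    ⟨fun x => ∑ i, p x i • Measure.dirac i, by
      refine Measure.measurable_of_measurable_coe _ fun s hs => ?_
      simp only [Measure.coe_finsetSum, Finset.sum_apply, Measure.smul_apply, smul_eq_mul]
      exact Finset.measurable_fun_sum _ fun i _ => (hp i).mul_const _⟩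
  have hκ : ∀ x, κ x = ∑ i, p x i • Measure.dirac i := fun x => rfl
  have : ProbabilityTheory.IsMarkovKernel κ := ⟨fun x => ⟨by
    rw [hκ]
    simp [Measure.coe_finsetSum, Finset.sum_apply, hsum]⟩⟩
  obtain ⟨f, hf, hfκ⟩ := κ.exists_measurable_map_eq_unitInterval
  refine ⟨f, hf, fun x g => ?_⟩
  rw [← lintegral_map (μ := volume) (measurable_of_countable g) hf.of_uncurry_left, hfκ, hκ]
  simp [lintegral_finsetSum_measure]

/-- A randomized algorithm with a fixed number of rounds, described by its sampling probabilities: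
in round `t` it pulls arm `i` with probability `weight t (z, h) i`, where `h` is the history and `z`
a random choice made in advance with law `initial`. -/
structure Policy (Z : Type) [MeasurableSpace Z] (n m : ℕ) where
  initial : Measure Z
  [isProbabilityMeasure_initial : IsProbabilityMeasure initial]
  rounds : ℕ
  weight : (t : ℕ) → Z × History n t → Fin n → ℝ≥0∞
  measurable_weight : ∀ t i, Measurable fun p => weight t p i
  sum_weight : ∀ t p, ∑ i, weight t p i = 1
  out : (t : ℕ) → Z × History n t → Finset (Fin n)
  card_out : ∀ t p, (out t p).card = m
  measurable_out : ∀ t S, MeasurableSet (out t ⁻¹' {S})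

attribute [instance] Policy.isProbabilityMeasure_initial

namespace Policy

variable {Z : Type} [MeasurableSpace Z] {n m : ℕ} [NeZero n] (π : Policy Z n m)

/-- A measurable map that draws the arm of round `t` with the prescribed probabilities from a
uniform random number. -/
def sampler (t : ℕ) : Z × History n t → I → Fin n :=
  (exists_sampler (π.measurable_weight t) (π.sum_weight t)).choose

theorem measurable_sampler (t : ℕ) : Measurable (Function.uncurry (π.sampler t)) :=
  (exists_sampler (π.measurable_weight t) (π.sum_weight t)).choose_spec.1

theorem lintegral_sampler (t : ℕ) (p : Z × History n t) (g : Fin n → ℝ≥0∞) :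
    ∫⁻ v, g (π.sampler t p v) = ∑ i, π.weight t p i * g i :=
  (exists_sampler (π.measurable_weight t) (π.sum_weight t)).choose_spec.2 p g

/-- The algorithm that plays a policy for `rounds` rounds and then outputs the set `out`. Its seed
consists of the initial choice and one uniform random number for each round. -/
def alg : BARAlgorithm n m where
  Seed := Z × (ℕ → I)
  seedLaw := π.initial.prod (Measure.infinitePi fun _ => volume)
  pull t q := π.sampler t (q.1.1, q.2) (q.1.2 t)
  measurable_pull t := (π.measurable_sampler t).comp
    (((measurable_fst.comp measurable_fst).prodMk measurable_snd).prodMk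
      ((measurable_pi_apply t).comp (measurable_snd.comp measurable_fst)))
  halt t := {_q | t = π.rounds}
  measurableSet_halt t := MeasurableSet.const _
  output t q := π.out t (q.1.1, q.2)
  card_output t q := π.card_out t _
  measurable_output t S := by
    have : Measurable fun q : (Z × (ℕ → I)) × History n t => ((q.1.1, q.2) : Z × History n t) :=
      (measurable_fst.comp measurable_fst).prodMk measurable_snd
    exact this (π.measurable_out t S)

theorem sampleSize_alg (ω : π.alg.Outcome) : π.alg.sampleSize ω = π.rounds :=
  (π.alg.sampleSize_eq_iff ω π.rounds).2 ⟨rfl, fun _ hu => hu.ne⟩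

theorem history_alg_update (z : Z) (u : ℕ → I) (x : ℕ → Fin n → I) {t s : ℕ} (hts : t ≤ s)
    (v : I) : π.alg.history ((z, Function.update u s v), x) t = π.alg.history ((z, u), x) t := by
  induction t with
  | zero => rfl
  | succ t ih =>
    have hpull : ∀ h, π.alg.pull t ((z, Function.update u s v), h) = π.alg.pull t ((z, u), h) := by
      intro h
      simp only [alg, Function.update_of_ne (show t ≠ s by omega)]
    simp only [BARAlgorithm.history, ih (by omega), hpull]

/-- What the policy knows before round `t`. -/
def state (t : ℕ) (ω : π.alg.Outcome) : Z × History n t := (ω.1.1, π.alg.history ω t)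

theorem measurable_state (t : ℕ) : Measurable (π.state t) :=
  (measurable_fst.comp measurable_fst).prodMk (π.alg.measurable_history t)

/-- Given what is known before round `t`, the arm of round `t` has the prescribed distribution: the
history does not depend on the random number used in that round. -/
theorem lintegral_arm (ν : BanditInstance n) (t : ℕ) {ψ : (Z × History n t) × Fin n → ℝ≥0∞}
    (hψ : Measurable ψ) :
    ∫⁻ ω, ψ (π.state t ω, π.alg.arm ω t) ∂π.alg.law ν
      = ∫⁻ ω, ∑ i, π.weight t (π.state t ω) i * ψ (π.state t ω, i) ∂π.alg.law ν := by
  have hst := π.measurable_state t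
  have hF : Measurable fun ω : π.alg.Outcome => ψ (π.state t ω, π.alg.arm ω t) :=
    hψ.comp (hst.prodMk (π.alg.measurable_arm t))
  have hG : Measurable fun ω : π.alg.Outcome =>
      ∑ i, π.weight t (π.state t ω) i * ψ (π.state t ω, i) :=
    Finset.measurable_fun_sum _ fun i _ => ((π.measurable_weight t i).comp hst).mul
      (hψ.comp (hst.prodMk measurable_const))
  unfold BARAlgorithm.law
  rw [lintegral_prod _ hF.aemeasurable, lintegral_prod _ hG.aemeasurable]
  change ∫⁻ s, _ ∂(π.initial.prod (Measure.infinitePi fun _ => volume))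
    = ∫⁻ s, _ ∂(π.initial.prod (Measure.infinitePi fun _ => volume))
  rw [lintegral_prod _ hF.lintegral_prod_right'.aemeasurable,
    lintegral_prod _ hG.lintegral_prod_right'.aemeasurable]
  refine lintegral_congr fun z => ?_
  have hz : Measurable fun u : ℕ → I =>
      ∫⁻ x, ψ (π.state t ((z, u), x), π.alg.arm ((z, u), x) t) ∂ν.tableLaw :=
    hF.lintegral_prod_right'.comp measurable_prodMk_left
  rw [lintegral_infinitePi_update (fun _ => volume) t hz]
  refine lintegral_congr fun u => ?_
  have hswap : Measurable fun q : I × (ℕ → Fin n → I) =>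
      ψ (π.state t ((z, Function.update u t q.1), q.2),
        π.alg.arm ((z, Function.update u t q.1), q.2) t) := by
    have : Measurable fun q : I × (ℕ → Fin n → I) =>
        (((z, Function.update u t q.1), q.2) : π.alg.Outcome) :=
      (measurable_const.prodMk ((measurable_update u).comp measurable_fst)).prodMk measurable_snd
    exact hF.comp this
  rw [lintegral_lintegral_swap hswap.aemeasurable]
  refine lintegral_congr fun x => ?_
  have hstate : ∀ v, π.state t ((z, Function.update u t v), x)
      = π.state t ((z, u), x) := fun v => by
    simp only [state, history_alg_update π z u x le_rfl]
  have harm : ∀ v, π.alg.arm ((z, Function.update u t v), x) t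
      = π.sampler t (π.state t ((z, u), x)) v :=
    fun v => by
      rw [← hstate v]
      simp only [BARAlgorithm.arm, alg, state, Function.update_self]
  simp only [hstate, harm]
  exact π.lintegral_sampler t _ fun i => ψ (π.state t ((z, u), x), i)

/-- Given what is known before round `t`, first the arm of round `t` and then its reward are drawn
from the prescribed distributions. -/
theorem lintegral_arm_reward (ν : BanditInstance n) (t : ℕ)
    {φ : ((Z × History n t) × Fin n) × I → ℝ≥0∞} (hφ : Measurable φ) :
    ∫⁻ ω, φ ((π.state t ω, π.alg.arm ω t), ω.2 t (π.alg.arm ω t)) ∂π.alg.law ν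
      = ∫⁻ ω, ∑ i, π.weight t (π.state t ω) i * ∫⁻ x, φ ((π.state t ω, i), x) ∂(ν i : Measure I)
          ∂π.alg.law ν := by
  have hmap : Measurable fun q : π.alg.Seed × History n t =>
      (((q.1.1, q.2), π.alg.pull t q) : (Z × History n t) × Fin n) :=
    (((measurable_fst (α := Z)).comp measurable_fst).prodMk measurable_snd).prodMk
      (π.alg.measurable_pull t)
  have h1 := π.alg.lintegral_reward ν t
    (φ := fun q => φ (((q.1.1.1, q.1.2), π.alg.pull t q.1), q.2))
    (hφ.comp ((hmap.comp measurable_fst).prodMk measurable_snd))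
  have h2 := π.lintegral_arm ν t
    (ψ := fun q => ∫⁻ x, φ (q, x) ∂(ν q.2 : Measure I))
    (ν.measurable_lintegral hφ measurable_snd)
  exact h1.trans h2

end Policy

/-! ### Regret of the Tsallis forecaster over a block of rounds -/

/-- The arm pulled in round `s` according to the history `h`; an arbitrary arm if round `s` is not
part of the history. -/
def armAt {n t : ℕ} [NeZero n] (h : History n t) (s : ℕ) : Fin n :=
  if hs : s < t then (h ⟨s, hs⟩).1 else 0

theorem measurable_armAt {n t : ℕ} [NeZero n] (s : ℕ) :
    Measurable fun h : History n t => armAt h s := by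
  unfold armAt
  split_ifs with hs
  · exact measurable_fst.comp (measurable_pi_apply _)
  · exact measurable_const

theorem BARAlgorithm.armAt_history {n m : ℕ} [NeZero n] (A : BARAlgorithm n m) (ω : A.Outcome)
    (t s : ℕ) : armAt (A.history ω t) s = if s < t then A.arm ω s else 0 := by
  unfold armAt
  split_ifs <;> simp [history_apply]

theorem Tsallis.measurable_prob_comp {ι K P : Type*} [MeasurableSpace K] [Countable K]
    [MeasurableSingletonClass K] [MeasurableSpace ι] [Countable ι] [MeasurableSingletonClass ι]
    [MeasurableSpace P] {η : ℝ} (hη : 0 < η) {b : K → Finset ι} (hb : ∀ κ, (b κ).Nonempty)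
    {f : P → K} {g : P → ι → ℝ} {i : P → ι} (hf : Measurable f) (hg : Measurable g)
    (hi : Measurable i) : Measurable fun p => prob η (b (f p)) (g p) (i p) := by
  have : Measurable fun q : (K × ι) × (ι → ℝ) => prob η (b q.1.1) q.2 q.1.2 :=
    measurable_from_prod_countable_right fun κ => measurable_prob hη (hb κ.1) κ.2
  exact this.comp ((hf.prodMk hi).prodMk hg)

section estimate

variable {Z : Type} {n : ℕ} [NeZero n]

/-- The part of the past on which the choice of the active arms depends: the initial choice and
the arm pulled in round `s`. -/
def key (s : ℕ) {t : ℕ} (p : Z × History n t) : Z × Fin n := (p.1, armAt p.2 s)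

/-- The importance-weighted estimates of the cumulative losses, counted from round `t₀` on, when
the arms are sampled with the Tsallis probabilities on the active set `b (key s p)`. -/
def estimate (η : ℝ) (b : Z × Fin n → Finset (Fin n)) (s t₀ : ℕ) :
    (t : ℕ) → Z × History n t → Fin n → ℝ
  | 0, _ => 0
  | t + 1, p =>
    let q : Z × History n t := (p.1, Fin.init p.2)
    let o := p.2 (Fin.last t)
    if t < t₀ then 0 else estimate η b s t₀ t q
      + Pi.single o.1 ((1 - (o.2 : ℝ)) / Tsallis.prob η (b (key s q)) (estimate η b s t₀ t q) o.1)

theorem estimate_self (η : ℝ) (b : Z × Fin n → Finset (Fin n)) (s t₀ : ℕ)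
    (p : Z × History n t₀) : estimate η b s t₀ t₀ p = 0 := by
  cases t₀ <;> simp [estimate]

variable [MeasurableSpace Z]

theorem measurable_key (s t : ℕ) : Measurable fun p : Z × History n t => key s p :=
  measurable_fst.prodMk ((measurable_armAt s).comp measurable_snd)

variable [Countable Z] [MeasurableSingletonClass Z]

theorem measurable_estimate {η : ℝ} (hη : 0 < η) {b : Z × Fin n → Finset (Fin n)}
    (hb : ∀ κ, (b κ).Nonempty) (s t₀ t : ℕ) :
    Measurable fun p : Z × History n t => estimate η b s t₀ t p := by
  induction t with
  | zero => exact measurable_const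
  | succ t ih =>
    simp only [estimate]
    split_ifs
    · exact measurable_const
    · have hq : Measurable fun p : Z × History n (t + 1) =>
          ((p.1, Fin.init p.2) : Z × History n t) :=
        measurable_fst.prodMk (measurable_pi_lambda _ fun j =>
          (measurable_pi_apply _).comp measurable_snd)
      have ho : Measurable fun p : Z × History n (t + 1) => p.2 (Fin.last t) :=
        (measurable_pi_apply _).comp measurable_snd
      have hval : Measurable fun p : Z × History n (t + 1) =>
          (1 - ((p.2 (Fin.last t)).2 : ℝ)) / Tsallis.prob η (b (key s (p.1, Fin.init p.2)))
            (estimate η b s t₀ t (p.1, Fin.init p.2)) (p.2 (Fin.last t)).1 :=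
        (measurable_const.sub (measurable_subtype_coe.comp (measurable_snd.comp ho))).div
          (Tsallis.measurable_prob_comp hη hb ((measurable_key s t).comp hq) (ih.comp hq)
            (measurable_fst.comp ho))
      refine (ih.comp hq).add (measurable_pi_lambda _ fun j => ?_)
      simp only [Pi.single_apply]
      exact Measurable.ite (measurableSet_eq_fun measurable_const (measurable_fst.comp ho)) hval
        measurable_const

end estimate

theorem BanditInstance.mean_mem {n : ℕ} (ν : BanditInstance n) (i : Fin n) :
    ν.mean i ∈ Set.Icc (0 : ℝ) 1 := by
  have hint : Integrable (fun x : I => (x : ℝ)) (ν i : Measure I) :=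
    Integrable.of_mem_Icc 0 1 (by fun_prop) (Filter.Eventually.of_forall fun x => x.2)
  refine ⟨integral_nonneg fun x => x.2.1, ?_⟩
  have := integral_mono hint (integrable_const (1 : ℝ)) fun x : I => x.2.2
  simpa [BanditInstance.mean] using this

theorem BanditInstance.lintegral_loss {n : ℕ} (ν : BanditInstance n) (i : Fin n) :
    ∫⁻ x, ENNReal.ofReal (1 - (x : ℝ)) ∂(ν i : Measure I) = ENNReal.ofReal (1 - ν.mean i) := by
  have hint : Integrable (fun x : I => (x : ℝ)) (ν i : Measure I) :=
    Integrable.of_mem_Icc 0 1 (by fun_prop) (Filter.Eventually.of_forall fun x => x.2)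
  have hint' : Integrable (fun x : I => 1 - (x : ℝ)) (ν i : Measure I) :=
    (integrable_const 1).sub hint
  rw [← ofReal_integral_eq_lintegral_ofReal hint'
      (Filter.Eventually.of_forall fun x : I => sub_nonneg.2 x.2.2),
    integral_sub (integrable_const 1) hint]
  simp [BanditInstance.mean]

namespace Policy

variable {Z : Type} [MeasurableSpace Z] {n m : ℕ} [NeZero n] (π : Policy Z n m)

/-- Over a block that starts after round `s`, or ends before it, `key s` does not change. In the
second case the arm in the key is the arbitrary one. -/
theorem key_state_eq {s t₀ T t : ℕ} (hs : s < t₀ ∨ t₀ + T ≤ s) (ht : t₀ ≤ t) (ht' : t < t₀ + T)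
    (ω : π.alg.Outcome) : key s (π.state t ω) = key s (π.state t₀ ω) := by
  simp only [key, state, BARAlgorithm.armAt_history]
  rcases hs with h | h
  · rw [if_pos (by omega), if_pos h]
  · rw [if_neg (by omega), if_neg (by omega)]

theorem estimate_state_succ (η : ℝ) (b : Z × Fin n → Finset (Fin n)) {s t₀ t : ℕ} (ht : t₀ ≤ t)
    (ω : π.alg.Outcome) :
    estimate η b s t₀ (t + 1) (π.state (t + 1) ω) = estimate η b s t₀ t (π.state t ω)
      + Pi.single (π.alg.arm ω t) ((1 - (ω.2 t (π.alg.arm ω t) : ℝ))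
        / Tsallis.prob η (b (key s (π.state t ω))) (estimate η b s t₀ t (π.state t ω))
          (π.alg.arm ω t)) := by
  have h1 : (Fin.init (π.alg.history ω (t + 1)) : History n t) = π.alg.history ω t := by
    rw [BARAlgorithm.history]
    exact Fin.init_snoc (α := fun _ => Fin n × I) _ _
  have h2 : π.alg.history ω (t + 1) (Fin.last t) = (π.alg.arm ω t, ω.2 t (π.alg.arm ω t)) := by
    rw [BARAlgorithm.history_apply]
    rfl
  simp only [estimate, state, h1, h2, not_lt.2 ht, if_false]

variable [Countable Z] [MeasurableSingletonClass Z]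

/-- The expected loss of the Tsallis forecaster over a block of `T` rounds, compared with an arm
`c` of the active set, both weighted by some `W ≥ 0`. The active set, `c` and `W` may depend on what
was known when the block began. -/
theorem sum_lintegral_loss_le (ν : BanditInstance n) {η : ℝ} (hη : 0 < η)
    {b : Z × Fin n → Finset (Fin n)} {s t₀ T M : ℕ} (hM : ∀ κ, (b κ).card ≤ M)
    (hw : ∀ t, t₀ ≤ t → t < t₀ + T → ∀ p i, π.weight t p i
      = ENNReal.ofReal (Tsallis.prob η (b (key s p)) (estimate η b s t₀ t p) i))
    (hs : s < t₀ ∨ t₀ + T ≤ s) {c : Z × Fin n → Fin n} (hc : ∀ κ, c κ ∈ b κ)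
    (W : Z × Fin n → ℝ≥0∞) :
    ∑ t ∈ Finset.range T, ∫⁻ ω, W (key s (π.state t₀ ω))
        * ENNReal.ofReal (1 - ν.mean (π.alg.arm ω (t₀ + t))) ∂π.alg.law ν
      ≤ T * ∫⁻ ω, W (key s (π.state t₀ ω))
          * ENNReal.ofReal (1 - ν.mean (c (key s (π.state t₀ ω)))) ∂π.alg.law ν
        + (∫⁻ ω, W (key s (π.state t₀ ω)) ∂π.alg.law ν)
          * ENNReal.ofReal (2 * √M / η + T * (η * √M)) := by
  have hb : ∀ κ, (b κ).Nonempty := fun κ => ⟨_, hc κ⟩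
  set A := π.alg with hA
  set κ₀ : A.Outcome → Z × Fin n := fun ω => key s (π.state t₀ ω) with hκ₀
  have hκ₀m : Measurable κ₀ := (measurable_key s t₀).comp (π.measurable_state t₀)
  have hWm : Measurable W := measurable_of_countable W
  have hWκ : Measurable fun ω => W (κ₀ ω) := hWm.comp hκ₀m
  -- the sampling probabilities of round `t`, as a function of what is known before it
  let p : (t : ℕ) → Z × History n t → Fin n → ℝ := fun t q i =>
    Tsallis.prob η (b (key s q)) (estimate η b s t₀ t q) i
  have hp : ∀ t, Measurable fun q : (Z × History n t) × Fin n => p t q.1 q.2 := fun t =>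
    Tsallis.measurable_prob_comp hη hb ((measurable_key s t).comp measurable_fst)
      ((measurable_estimate hη hb s t₀ t).comp measurable_fst) measurable_snd
  have hkey : ∀ t ∈ Finset.range T, ∀ ω, key s (π.state (t₀ + t) ω) = κ₀ ω := fun t ht ω =>
    π.key_state_eq hs (Nat.le_add_right _ _) (by have := Finset.mem_range.1 ht; omega) ω
  have hweight : ∀ t ∈ Finset.range T, ∀ q i,
      π.weight (t₀ + t) q i = ENNReal.ofReal (p (t₀ + t) q i) := fun t ht q i =>
    hw _ (Nat.le_add_right _ _) (by have := Finset.mem_range.1 ht; omega) q i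
  have hppos : ∀ t, ∀ q : Z × History n t, ∀ i ∈ b (key s q), 0 < p t q i := fun t q i hi =>
    Tsallis.prob_pos hη hi
  have hlossm : Measurable fun x : I => ENNReal.ofReal (1 - (x : ℝ)) :=
    (measurable_const.sub measurable_subtype_coe).ennreal_ofReal
  let loss : ℕ → A.Outcome → ℝ≥0∞ := fun t ω =>
    W (κ₀ ω) * ENNReal.ofReal (1 - (ω.2 (t₀ + t) (A.arm ω (t₀ + t)) : ℝ))
  let est : ℕ → A.Outcome → ℝ≥0∞ := fun t ω =>
    W (κ₀ ω) * (if A.arm ω (t₀ + t) = c (κ₀ ω) then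
      ENNReal.ofReal ((1 - (ω.2 (t₀ + t) (A.arm ω (t₀ + t)) : ℝ))
        / p (t₀ + t) (π.state (t₀ + t) ω) (c (κ₀ ω))) else 0)
  let var : ℕ → A.Outcome → ℝ≥0∞ := fun t ω =>
    W (κ₀ ω) * (ENNReal.ofReal η
      * (ENNReal.ofReal √(p (t₀ + t) (π.state (t₀ + t) ω) (A.arm ω (t₀ + t))))⁻¹)
  -- the observed losses, the estimate for the comparator, and the variance term of each round
  have hloss : ∀ t ∈ Finset.range T, ∫⁻ ω, loss t ω ∂A.law ν
      = ∫⁻ ω, W (κ₀ ω) * ENNReal.ofReal (1 - ν.mean (A.arm ω (t₀ + t))) ∂A.law ν := by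
    intro t ht
    have hφ : Measurable fun q : (A.Seed × History n (t₀ + t)) × I =>
        W (key s (q.1.1.1, q.1.2)) * ENNReal.ofReal (1 - (q.2 : ℝ)) := by
      have : Measurable fun q : (A.Seed × History n (t₀ + t)) × I =>
          ((q.1.1.1, q.1.2) : Z × History n (t₀ + t)) :=
        (((measurable_fst (α := Z)).comp measurable_fst).comp measurable_fst).prodMk
          (measurable_snd.comp measurable_fst)
      exact (hWm.comp ((measurable_key s _).comp this)).mul (hlossm.comp measurable_snd)
    have h := A.lintegral_reward ν (t₀ + t) hφ
    have hk : ∀ ω : A.Outcome, key s (ω.1.1, A.history ω (t₀ + t)) = κ₀ ω := hkey t ht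
    simp only [hk] at h
    rw [h]
    refine lintegral_congr fun ω => ?_
    rw [lintegral_const_mul _ hlossm, ν.lintegral_loss]
  have hest : ∀ t ∈ Finset.range T, ∫⁻ ω, est t ω ∂A.law ν
      = ∫⁻ ω, W (κ₀ ω) * ENNReal.ofReal (1 - ν.mean (c (κ₀ ω))) ∂A.law ν := by
    intro t ht
    have hck : Measurable fun q : Z × History n (t₀ + t) => c (key s q) :=
      (measurable_of_countable c).comp (measurable_key s _)
    have hφ : Measurable fun q : ((Z × History n (t₀ + t)) × Fin n) × I =>
        W (key s q.1.1) * (if q.1.2 = c (key s q.1.1) then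
          ENNReal.ofReal ((1 - (q.2 : ℝ)) / p (t₀ + t) q.1.1 (c (key s q.1.1))) else 0) := by
      have h1 : Measurable fun q : ((Z × History n (t₀ + t)) × Fin n) × I => q.1.1 :=
        measurable_fst.comp measurable_fst
      refine (hWm.comp ((measurable_key s _).comp h1)).mul (Measurable.ite
        (measurableSet_eq_fun (measurable_snd.comp measurable_fst) (hck.comp h1))
        (Measurable.ennreal_ofReal ?_) measurable_const)
      exact (measurable_const.sub (measurable_subtype_coe.comp measurable_snd)).div
        ((hp _).comp (h1.prodMk (hck.comp h1)))
    have h := π.lintegral_arm_reward ν (t₀ + t) hφ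
    simp only [hkey t ht] at h
    refine h.trans (lintegral_congr fun ω => ?_)
    rw [Finset.sum_eq_single (c (κ₀ ω))]
    · have hpos : 0 < p (t₀ + t) (π.state (t₀ + t) ω) (c (κ₀ ω)) :=
        hppos _ _ _ (by rw [hkey t ht]; exact hc _)
      simp only [if_true]
      have hdiv : ∀ x : I, ENNReal.ofReal ((1 - (x : ℝ))
          / p (t₀ + t) (π.state (t₀ + t) ω) (c (κ₀ ω)))
          = (ENNReal.ofReal (p (t₀ + t) (π.state (t₀ + t) ω) (c (κ₀ ω))))⁻¹
            * ENNReal.ofReal (1 - (x : ℝ)) := fun x => by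
        rw [ENNReal.ofReal_div_of_pos hpos, div_eq_mul_inv, mul_comm]
      simp only [hdiv]
      rw [lintegral_const_mul _ (hlossm.const_mul _), lintegral_const_mul _ hlossm,
        ν.lintegral_loss, hweight t ht, mul_left_comm, ← mul_assoc (ENNReal.ofReal (p _ _ _)),
        ENNReal.mul_inv_cancel (by simpa using hpos) ENNReal.ofReal_ne_top, one_mul]
    · intro i _ hi
      simp [hi]
    · simp
  have hvar : ∀ t ∈ Finset.range T, ∫⁻ ω, var t ω ∂A.law ν
      ≤ (∫⁻ ω, W (κ₀ ω) ∂A.law ν) * ENNReal.ofReal (η * √M) := by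
    intro t ht
    have hψ : Measurable fun q : (Z × History n (t₀ + t)) × Fin n =>
        W (key s q.1) * (ENNReal.ofReal η * (ENNReal.ofReal √(p (t₀ + t) q.1 q.2))⁻¹) :=
      (hWm.comp ((measurable_key s _).comp measurable_fst)).mul
        ((hp _).sqrt.ennreal_ofReal.inv.const_mul _)
    have h := π.lintegral_arm ν (t₀ + t) hψ
    simp only [hkey t ht] at h
    rw [← lintegral_mul_const _ hWκ]
    refine h.trans_le (lintegral_mono fun ω => ?_)
    have hterm : ∀ i, π.weight (t₀ + t) (π.state (t₀ + t) ω) i * (W (κ₀ ω) * (ENNReal.ofReal η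
        * (ENNReal.ofReal √(p (t₀ + t) (π.state (t₀ + t) ω) i))⁻¹))
        = W (κ₀ ω) * (ENNReal.ofReal η
          * ENNReal.ofReal √(p (t₀ + t) (π.state (t₀ + t) ω) i)) := by
      intro i
      rw [hweight t ht, mul_left_comm, mul_left_comm _ (ENNReal.ofReal η)]
      congr 2
      set y := p (t₀ + t) (π.state (t₀ + t) ω) i with hy
      have hy0 : 0 ≤ y := Tsallis.prob_nonneg i
      rcases hy0.eq_or_lt with h0 | h0
      · simp [← h0]
      · have hs0 : 0 < √y := Real.sqrt_pos.2 h0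
        rw [← ENNReal.ofReal_inv_of_pos hs0, ← ENNReal.ofReal_mul hy0, ← div_eq_mul_inv,
          Real.div_sqrt]
    simp only [hterm]
    rw [← Finset.mul_sum, ← Finset.mul_sum, ← ENNReal.ofReal_sum_of_nonneg fun i _ =>
      Real.sqrt_nonneg _, ← ENNReal.ofReal_mul hη.le]
    gcongr
    refine (Tsallis.sum_sqrt_prob_le hη (hb _)).trans (Real.sqrt_le_sqrt ?_)
    exact_mod_cast hM _
  -- the pathwise bound
  have hpath : ∀ ω : A.Outcome, ∑ t ∈ Finset.range T, loss t ω
      ≤ ∑ t ∈ Finset.range T, est t ω + W (κ₀ ω) * ENNReal.ofReal (2 * √M / η)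
        + ∑ t ∈ Finset.range T, var t ω := by
    intro ω
    have h := Tsallis.sum_loss_le (B := b (κ₀ ω)) (η := η) (T := T) (c := c (κ₀ ω))
      (L := fun t => estimate η b s t₀ (t₀ + t) (π.state (t₀ + t) ω))
      (a := fun t => A.arm ω (t₀ + t))
      (x := fun t => 1 - (ω.2 (t₀ + t) (A.arm ω (t₀ + t)) : ℝ)) hη
      (estimate_self η b s t₀ _) (fun t => sub_nonneg.2 (ω.2 _ _).2.2)
      (fun t => sub_le_self _ (ω.2 _ _).2.1) (fun t ht => by
        rw [← hkey t (Finset.mem_range.2 ht) ω]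
        exact π.estimate_state_succ (s := s) η b (Nat.le_add_right t₀ t) ω) (hc _)
    have hM' : 2 * √((b (κ₀ ω)).card : ℝ) / η ≤ 2 * √M / η := by
      have : ((b (κ₀ ω)).card : ℝ) ≤ M := by exact_mod_cast hM _
      gcongr
    have h2 := mul_le_mul_right (h.trans (add_le_add_left (add_le_add_right
      (ENNReal.ofReal_le_ofReal hM') _) _)) (W (κ₀ ω))
    simp only [mul_add, Finset.mul_sum] at h2
    refine h2.trans (le_of_eq ?_)
    congr 1
    · congr 1
      refine Finset.sum_congr rfl fun t ht => ?_
      have hk := hkey t ht ω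
      simp only [est, p, hk]
    · refine Finset.sum_congr rfl fun t ht => ?_
      have hk := hkey t ht ω
      simp only [var, p, hk]
  have hstm : ∀ t, Measurable (π.state t) := fun t => π.measurable_state t
  have hlossω : ∀ t, Measurable (loss t) := fun t =>
    hWκ.mul (hlossm.comp (A.measurable_reward _))
  have hcω : Measurable fun ω => c (κ₀ ω) := (measurable_of_countable c).comp hκ₀m
  have hestω : ∀ t, Measurable (est t) := fun t =>
    hWκ.mul (Measurable.ite (measurableSet_eq_fun (A.measurable_arm _) hcω)
      (((measurable_const.sub (measurable_subtype_coe.comp (A.measurable_reward _))).div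
        ((hp _).comp ((hstm _).prodMk hcω))).ennreal_ofReal) measurable_const)
  rw [← Finset.sum_congr rfl hloss, ← lintegral_finsetSum _ fun t _ => hlossω t]
  refine (lintegral_mono hpath).trans ?_
  have hestsum : Measurable fun ω => ∑ t ∈ Finset.range T, est t ω
      + W (κ₀ ω) * ENNReal.ofReal (2 * √M / η) :=
    (Finset.measurable_fun_sum _ fun t _ => hestω t).add (hWκ.mul_const _)
  rw [lintegral_add_left hestsum,
    lintegral_add_left (Finset.measurable_fun_sum _ fun t _ => hestω t),
    lintegral_finsetSum _ fun t _ => hestω t, Finset.sum_congr rfl hest, Finset.sum_const,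
    Finset.card_range, nsmul_eq_mul, lintegral_mul_const _ hWκ, add_assoc]
  gcongr
  rw [ENNReal.ofReal_add (by positivity) (by positivity), mul_add]
  gcongr
  have hvarω : ∀ t, Measurable (var t) := fun t =>
    hWκ.mul (((hp _).comp ((hstm _).prodMk (A.measurable_arm _))).sqrt.ennreal_ofReal.inv.const_mul
      _)
  rw [lintegral_finsetSum _ fun t _ => hvarω t]
  refine (Finset.sum_le_sum hvar).trans (le_of_eq ?_)
  rw [Finset.sum_const, Finset.card_range, nsmul_eq_mul,
    ENNReal.ofReal_mul (p := (T : ℝ)) (by positivity), ENNReal.ofReal_natCast]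
  exact mul_left_comm _ _ _

end Policy

namespace BanditInstance

variable {n : ℕ} (ν : BanditInstance n)

theorem mean_le_bestMean (i : Fin n) : ν.mean i ≤ ν.bestMean :=
  le_ciSup (Set.finite_range ν.mean).bddAbove i

theorem gap_nonneg (i : Fin n) : 0 ≤ ν.gap i := sub_nonneg.2 (ν.mean_le_bestMean i)

theorem setGap_le_gap {S : Finset (Fin n)} {i : Fin n} (hi : i ∈ S) : ν.setGap S ≤ ν.gap i :=
  sub_le_sub_left (le_ciSup (f := fun j : S => ν.mean j) (Set.finite_range _).bddAbove ⟨i, hi⟩) _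

variable [NeZero n]

theorem exists_gap_eq_zero : ∃ i, ν.gap i = 0 := by
  obtain ⟨i, hi⟩ := exists_eq_ciSup_of_finite (f := ν.mean)
  exact ⟨i, by rw [gap, bestMean, hi, sub_self]⟩

theorem bestMean_le_one : ν.bestMean ≤ 1 := ciSup_le fun i => (ν.mean_mem i).2

theorem gap_le_one (i : Fin n) : ν.gap i ≤ 1 := by
  have := ν.bestMean_le_one
  have := (ν.mean_mem i).1
  unfold gap
  linarith

theorem ofReal_loss (i : Fin n) : ENNReal.ofReal (1 - ν.mean i)
    = ENNReal.ofReal (1 - ν.bestMean) + ENNReal.ofReal (ν.gap i) := by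
  rw [← ENNReal.ofReal_add (sub_nonneg.2 ν.bestMean_le_one) (ν.gap_nonneg i), gap]
  congr 1
  ring

end BanditInstance

/-- The regret of an algorithm with a fixed number of samples, as a sum over the rounds. -/
theorem BARAlgorithm.regret_eq_sum {n m : ℕ} (A : BARAlgorithm n m) {N : ℕ}
    (hN : A.HasFixedSampleSize N) (ν : BanditInstance n) :
    A.regret ν = ∑ t ∈ Finset.range N, ∫⁻ ω, ENNReal.ofReal (ν.gap (A.arm ω t)) ∂A.law ν := by
  have hm : ∀ t, Measurable fun ω => ENNReal.ofReal (ν.gap (A.arm ω t)) := fun t =>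
    (measurable_of_countable fun i => ENNReal.ofReal (ν.gap i)).comp (A.measurable_arm t)
  rw [← lintegral_finsetSum _ fun t _ => hm t]
  refine lintegral_congr fun ω => ?_
  have hcount : ∀ i, A.pullCount ω i = ∑ t ∈ Finset.range N, if A.arm ω t = i then 1 else 0 := by
    intro i
    rw [pullCount, tsum_eq_sum (s := Finset.range N)]
    · refine Finset.sum_congr rfl fun t ht => ?_
      have : (t : ℕ∞) < A.sampleSize ω := by
        rw [hN ω]; exact_mod_cast Finset.mem_range.1 ht
      simp [this]
    · intro t ht
      have : ¬ (t : ℕ∞) < A.sampleSize ω := by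
        rw [hN ω]; exact_mod_cast fun h => ht (Finset.mem_range.2 h)
      simp [this]
  simp only [hcount, Finset.mul_sum]
  rw [Finset.sum_comm]
  refine Finset.sum_congr rfl fun t _ => ?_
  simp

namespace Policy

section

variable {Z : Type} [MeasurableSpace Z] [Countable Z] [MeasurableSingletonClass Z] {n m : ℕ}
  [NeZero n] (π : Policy Z n m)

/-- The regret of the Tsallis forecaster over a block of `T` rounds, with the learning rate
`1 / √T`. -/
theorem sum_lintegral_gap_le (ν : BanditInstance n) {b : Z × Fin n → Finset (Fin n)}
    {s t₀ T M : ℕ} (hT : 0 < T) (hM : ∀ κ, (b κ).card ≤ M)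
    (hw : ∀ t, t₀ ≤ t → t < t₀ + T → ∀ p i, π.weight t p i = ENNReal.ofReal
      (Tsallis.prob (√(T : ℝ))⁻¹ (b (key s p)) (estimate (√(T : ℝ))⁻¹ b s t₀ t p) i))
    (hs : s < t₀ ∨ t₀ + T ≤ s) {c : Z × Fin n → Fin n} (hc : ∀ κ, c κ ∈ b κ)
    {W : Z × Fin n → ℝ≥0∞} (hW : ∀ κ, W κ ≤ 1) :
    ∑ t ∈ Finset.range T, ∫⁻ ω, W (key s (π.state t₀ ω))
        * ENNReal.ofReal (ν.gap (π.alg.arm ω (t₀ + t))) ∂π.alg.law ν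
      ≤ T * ∫⁻ ω, W (key s (π.state t₀ ω))
          * ENNReal.ofReal (ν.gap (c (key s (π.state t₀ ω)))) ∂π.alg.law ν
        + (∫⁻ ω, W (key s (π.state t₀ ω)) ∂π.alg.law ν)
          * ENNReal.ofReal (3 * √(M * T)) := by
  have hT' : (0 : ℝ) < T := by exact_mod_cast hT
  have hsT : 0 < √(T : ℝ) := Real.sqrt_pos.2 hT'
  have h := π.sum_lintegral_loss_le ν (inv_pos.2 hsT) hM hw hs hc W
  have hκm : Measurable fun ω => key s (π.state t₀ ω) :=
    (measurable_key s t₀).comp (π.measurable_state t₀)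
  have hWm : Measurable fun ω => W (key s (π.state t₀ ω)) :=
    (measurable_of_countable W).comp hκm
  have hfin : ∫⁻ ω, W (key s (π.state t₀ ω)) ∂π.alg.law ν ≠ ⊤ := by
    refine ne_top_of_le_ne_top ENNReal.one_ne_top ((lintegral_mono fun ω => hW _).trans ?_)
    simp
  have hbound : 2 * √(M : ℝ) / (√(T : ℝ))⁻¹ + T * ((√(T : ℝ))⁻¹ * √M) = 3 * √(M * T) := by
    have h1 : (T : ℝ) * ((√(T : ℝ))⁻¹ * √M) = √T * √M := by
      nth_rewrite 1 [← Real.mul_self_sqrt hT'.le]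
      field_simp
    rw [h1, div_inv_eq_mul, Real.sqrt_mul (Nat.cast_nonneg M)]
    ring
  rw [hbound] at h
  simp only [ν.ofReal_loss, mul_add] at h
  simp only [lintegral_add_left (hWm.mul_const _), lintegral_mul_const _ hWm] at h
  rw [Finset.sum_add_distrib, Finset.sum_const, Finset.card_range, nsmul_eq_mul, mul_add,
    add_assoc, ENNReal.add_le_add_iff_left] at h
  · exact h
  · exact ENNReal.mul_ne_top (ENNReal.natCast_ne_top T)
      (ENNReal.mul_ne_top hfin ENNReal.ofReal_ne_top)

end

section

variable {Z : Type} [MeasurableSpace Z] {n m : ℕ} [NeZero n] (π : Policy Z n m)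

theorem hasFixedSampleSize : π.alg.HasFixedSampleSize π.rounds := π.sampleSize_alg

theorem lintegral_initial (ν : BanditInstance n) {f : Z → ℝ≥0∞} (hf : Measurable f) :
    ∫⁻ ω, f ω.1.1 ∂π.alg.law ν = ∫⁻ z, f z ∂π.initial := by
  have h1 : Measurable fun ω : (Z × (ℕ → I)) × (ℕ → Fin n → I) => f ω.1.1 :=
    hf.comp (measurable_fst.comp measurable_fst)
  have h2 : Measurable fun s : Z × (ℕ → I) => f s.1 := hf.comp measurable_fst
  change ∫⁻ ω : (Z × (ℕ → I)) × (ℕ → Fin n → I), f ω.1.1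
    ∂(π.initial.prod (Measure.infinitePi fun _ => volume)).prod ν.tableLaw = _
  rw [lintegral_prod _ h1.aemeasurable]
  simp only [lintegral_const, measure_univ, mul_one]
  rw [lintegral_prod _ h2.aemeasurable]
  simp

end

end Policy

/-- The probability of arm `i` under the empirical distribution of the arms pulled in the `T` rounds
from round `t₁` on. -/
def empirical {n t : ℕ} [NeZero n] (t₁ T : ℕ) (h : History n t) (i : Fin n) : ℝ≥0∞ :=
  (T : ℝ≥0∞)⁻¹ * ∑ t ∈ Finset.range T, if armAt h (t₁ + t) = i then 1 else 0

theorem measurable_empirical {n t : ℕ} [NeZero n] (t₁ T : ℕ) (i : Fin n) :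
    Measurable fun h : History n t => empirical t₁ T h i :=
  (Finset.measurable_fun_sum _ fun s _ => Measurable.ite
    (measurable_armAt (t₁ + s) (measurableSet_singleton i)) measurable_const
      measurable_const).const_mul _

theorem sum_empirical {n t : ℕ} [NeZero n] (t₁ : ℕ) {T : ℕ} (hT : 0 < T) (h : History n t) :
    ∑ i, empirical t₁ T h i = 1 := by
  simp only [empirical]
  rw [← Finset.mul_sum, Finset.sum_comm]
  simp only [Finset.sum_ite_eq, Finset.mem_univ, if_true, Finset.sum_const, Finset.card_range,
    nsmul_eq_mul, mul_one]
  exact ENNReal.inv_mul_cancel (by exact_mod_cast hT.ne') (ENNReal.natCast_ne_top T)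

/-- Sampling from the empirical distribution of a block turns its total into an average. -/
theorem Policy.lintegral_empirical {Z : Type} [MeasurableSpace Z] {n m : ℕ} [NeZero n]
    (π : Policy Z n m) (ν : BanditInstance n) {t₁ T u : ℕ} (hu : t₁ + T ≤ u)
    (hw : ∀ p i, π.weight u p i = empirical t₁ T p.2 i) {W : Z → ℝ≥0∞} (hW : Measurable W)
    (g : Fin n → ℝ≥0∞) :
    ∫⁻ ω, W ω.1.1 * g (π.alg.arm ω u) ∂π.alg.law ν
      = (T : ℝ≥0∞)⁻¹ * ∑ t ∈ Finset.range T,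
          ∫⁻ ω, W ω.1.1 * g (π.alg.arm ω (t₁ + t)) ∂π.alg.law ν := by
  have hg : Measurable g := measurable_of_countable g
  have h := π.lintegral_arm ν u (ψ := fun q => W q.1.1 * g q.2)
    ((hW.comp (measurable_fst.comp measurable_fst)).mul (hg.comp measurable_snd))
  have hm : ∀ t, Measurable fun ω : π.alg.Outcome => W ω.1.1 * g (π.alg.arm ω t) := fun t =>
    (hW.comp ((measurable_fst (α := Z)).comp measurable_fst)).mul
      (hg.comp (π.alg.measurable_arm t))
  refine h.trans ?_
  rw [← lintegral_finsetSum _ fun t _ => hm _,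
    ← lintegral_const_mul _ (Finset.measurable_fun_sum _ fun t _ => hm _)]
  refine lintegral_congr fun ω => ?_
  have harm : ∀ t ∈ Finset.range T,
      armAt (π.state u ω).2 (t₁ + t) = π.alg.arm ω (t₁ + t) := fun t ht => by
    have := Finset.mem_range.1 ht
    rw [state, BARAlgorithm.armAt_history, if_pos (by omega)]
  simp only [hw, empirical, mul_assoc, Finset.sum_mul]
  rw [← Finset.mul_sum, Finset.sum_comm]
  congr 1
  refine Finset.sum_congr rfl fun t ht => ?_
  rw [harm t ht]
  simp [state]

/-! ### Random blocks of arms -/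

/-- The cyclic block of `q` consecutive arms that begins with `z`. -/
def arc {n : ℕ} (q : ℕ) (z : Fin n) : Finset (Fin n) :=
  Finset.univ.filter fun i => (i - z).val < q

section arc

variable {n q : ℕ}

theorem card_filter_val_lt (hq : q ≤ n) :
    (Finset.univ.filter fun i : Fin n => i.val < q).card = q := by
  rw [Fin.card_filter_val_lt, min_eq_right hq]

variable [NeZero n]

theorem card_arc (hq : q ≤ n) (z : Fin n) : (arc q z).card = q :=
  (Finset.card_equiv (Equiv.subRight z) fun i => by simp [arc]).trans
    (card_filter_val_lt hq)

theorem mem_arc_self (hq : 0 < q) (z : Fin n) : z ∈ arc q z := by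
  simp [arc, hq]

/-- The uniform distribution on the arms. -/
def uniformArm (n : ℕ) : Measure (Fin n) := (n : ℝ≥0∞)⁻¹ • Measure.count

instance : IsProbabilityMeasure (uniformArm n) := ⟨by
  simp only [uniformArm, Measure.smul_apply, Measure.count_univ, smul_eq_mul]
  simp [ENNReal.inv_mul_cancel, NeZero.ne]⟩

/-- A uniformly random block of `q` arms contains each arm with probability `q / n`. -/
theorem lintegral_mem_arc (hq : q ≤ n) (i : Fin n) :
    ∫⁻ z, (if i ∈ arc q z then 1 else 0) ∂uniformArm n = ENNReal.ofReal ((q : ℝ) / n) := by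
  have hn : (0 : ℝ) < n := by exact_mod_cast NeZero.pos n
  have hcard : (Finset.univ.filter fun z : Fin n => i ∈ arc q z).card = q :=
    (Finset.card_equiv (Equiv.subLeft i) fun z => by simp [arc]).trans
      (card_filter_val_lt hq)
  rw [uniformArm, lintegral_smul_measure, lintegral_count, tsum_fintype, Finset.sum_boole, hcard,
    smul_eq_mul, ENNReal.ofReal_div_of_pos hn, ENNReal.ofReal_natCast, ENNReal.ofReal_natCast,
    mul_comm, div_eq_mul_inv]

end arc

/-! ### The upper bound -/

section zeroSample

variable {n : ℕ} [NeZero n] {m k : ℕ}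

/-- The algorithm that drops a random block of `k` arms without taking any sample. -/
def blindPolicy (hmk : m + k = n) : Policy (Fin n) n m where
  initial := uniformArm n
  rounds := 0
  weight _ _ i := if i = 0 then 1 else 0
  measurable_weight _ _ := measurable_const
  sum_weight _ _ := by simp
  out _ p := (arc k p.1)ᶜ
  card_out _ p := by
    rw [Finset.card_compl, card_arc (by omega), Fintype.card_fin]
    omega
  measurable_out t S := by
    have : Measurable fun p : Fin n × History n t => p.1 := measurable_fst
    exact this (MeasurableSet.of_discrete (s := {z | (arc k z)ᶜ = S}))

theorem regretComplexity_blindPolicy (hmk : m + k = n) :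
    (blindPolicy hmk).alg.regretComplexity = 0 := by
  refine le_antisymm (iSup_le fun ν => ?_) zero_le
  rw [(blindPolicy hmk).alg.regret_eq_sum (blindPolicy hmk).hasFixedSampleSize]
  simp [blindPolicy]

theorem expectedGap_blindPolicy_le (hmk : m + k = n) (ν : BanditInstance n) :
    (blindPolicy hmk).alg.expectedGap ν ≤ ENNReal.ofReal ((k : ℝ) / n) := by
  set π := blindPolicy hmk with hπ
  obtain ⟨i, hi⟩ := ν.exists_gap_eq_zero
  rw [← lintegral_mem_arc (n := n) (q := k) (by omega) i]
  refine le_trans (lintegral_mono fun ω => ?_)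
    (π.lintegral_initial ν (f := fun z => if i ∈ arc k z then 1 else 0)
      (measurable_of_countable _)).le
  have hS : π.alg.sampleSize ω = (0 : ℕ) := π.sampleSize_alg ω
  have hret : π.alg.retained ω = (arc k ω.1.1)ᶜ := π.alg.retained_eq hS
  simp only [hS, ENat.natCast_ne_top, if_false, hret]
  by_cases hmem : i ∈ arc k ω.1.1
  · rw [if_pos hmem]
    rcases Finset.eq_empty_or_nonempty (arc k ω.1.1)ᶜ with h | ⟨j, hj⟩
    · rw [h, BanditInstance.setGap]
      simpa using ν.bestMean_le_one
    · refine ENNReal.ofReal_le_one.2 ((ν.setGap_le_gap hj).trans (ν.gap_le_one j))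
  · rw [if_neg hmem]
    have : i ∈ (arc k ω.1.1)ᶜ := Finset.mem_compl.2 hmem
    exact (ENNReal.ofReal_eq_zero.2 (hi ▸ ν.setGap_le_gap this)).le

end zeroSample

section twoPhase

variable {n m k T : ℕ}

/-- The arms dropped by the two-phase algorithm: all arms of the block that begins with `κ.1` but
one, which is the arm `κ.2` if that arm belongs to the block. -/
def dropped (k : ℕ) (κ : Fin n × Fin n) : Finset (Fin n) :=
  (arc (k + 1) κ.1).erase (if κ.2 ∈ arc (k + 1) κ.1 then κ.2 else κ.1)

theorem notMem_dropped (k : ℕ) (κ : Fin n × Fin n) : κ.2 ∉ dropped k κ := by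
  unfold dropped
  split_ifs with h
  · exact Finset.notMem_erase _ _
  · exact fun h' => h (Finset.mem_of_mem_erase h')

variable [NeZero n]

/-- The sampling probabilities of the two-phase algorithm. It plays the Tsallis forecaster on all
arms for `T` rounds and then pulls an arm `J` drawn from the empirical distribution of these rounds;
next it plays the forecaster for `T` rounds on the arm `J` and a random block of `k + 1` arms, and
then pulls an arm drawn from the empirical distribution of this second phase. The active set of the
second phase is read off from `key T`, since `J` is the arm of round `T`. -/
def twoPhaseWeight (k T t : ℕ) (p : Fin n × History n t) (i : Fin n) : ℝ≥0∞ :=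
  if t < T then ENNReal.ofReal (Tsallis.prob (√(T : ℝ))⁻¹ Finset.univ
    (estimate (√(T : ℝ))⁻¹ (fun _ => Finset.univ) T 0 t p) i)
  else if t = T then empirical 0 T p.2 i
  else if t < T + 1 + T then ENNReal.ofReal (Tsallis.prob (√(T : ℝ))⁻¹
    (insert (key T p).2 (arc (k + 1) (key T p).1))
    (estimate (√(T : ℝ))⁻¹ (fun κ => insert κ.2 (arc (k + 1) κ.1)) T (T + 1) t p) i)
  else empirical (T + 1) T p.2 i

theorem card_dropped (hk : k + 1 ≤ n) (κ : Fin n × Fin n) : (dropped k κ).card = k := by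
  rw [dropped, Finset.card_erase_of_mem, card_arc hk, Nat.add_sub_cancel]
  split_ifs with h
  exacts [h, mem_arc_self k.succ_pos _]

/-- The two-phase algorithm. It drops all arms of its random block but one, and never the last arm
it pulls. -/
def twoPhase (hm : 1 ≤ m) (hmk : m + k = n) (hT : 0 < T) : Policy (Fin n) n m where
  initial := uniformArm n
  rounds := T + 1 + T + 1
  weight := twoPhaseWeight k T
  measurable_weight t i := by
    have hη : 0 < (√(T : ℝ))⁻¹ := inv_pos.2 (Real.sqrt_pos.2 (by exact_mod_cast hT))
    unfold twoPhaseWeight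
    split_ifs
    · exact ((Tsallis.measurable_prob hη Finset.univ_nonempty i).comp
        (measurable_estimate hη (fun _ => Finset.univ_nonempty) T 0 t)).ennreal_ofReal
    · exact (measurable_empirical 0 T i).comp measurable_snd
    · exact (Tsallis.measurable_prob_comp hη
        (b := fun κ : Fin n × Fin n => insert κ.2 (arc (k + 1) κ.1))
        (fun κ => Finset.insert_nonempty _ _) (measurable_key T t)
        (measurable_estimate hη (fun κ => Finset.insert_nonempty _ _) T (T + 1) t)
        measurable_const).ennreal_ofReal
    · exact (measurable_empirical (T + 1) T i).comp measurable_snd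
  sum_weight t p := by
    have hη : 0 < (√(T : ℝ))⁻¹ := inv_pos.2 (Real.sqrt_pos.2 (by exact_mod_cast hT))
    unfold twoPhaseWeight
    split_ifs
    · rw [← ENNReal.ofReal_sum_of_nonneg fun i _ => Tsallis.prob_nonneg i,
        Tsallis.sum_prob hη Finset.univ_nonempty, ENNReal.ofReal_one]
    · exact sum_empirical 0 hT p.2
    · rw [← ENNReal.ofReal_sum_of_nonneg fun i _ => Tsallis.prob_nonneg i,
        Tsallis.sum_prob hη (Finset.insert_nonempty _ _), ENNReal.ofReal_one]
    · exact sum_empirical (T + 1) hT p.2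
  out t p := (dropped k (key (T + 1 + T) p))ᶜ
  card_out t p := by
    rw [Finset.card_compl, card_dropped (by omega), Fintype.card_fin]
    omega
  measurable_out t S :=
    measurable_key (T + 1 + T) t (MeasurableSet.of_discrete (s := {κ | (dropped k κ)ᶜ = S}))

variable (hm : 1 ≤ m) (hmk : m + k = n) (hT : 0 < T)

theorem sum_gap_first_phase_le (ν : BanditInstance n) :
    ∑ t ∈ Finset.range T, ∫⁻ ω, ENNReal.ofReal (ν.gap ((twoPhase hm hmk hT).alg.arm ω t))
        ∂(twoPhase hm hmk hT).alg.law ν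
      ≤ ENNReal.ofReal (3 * √(n * T)) := by
  obtain ⟨i, hi⟩ := ν.exists_gap_eq_zero
  have h := (twoPhase hm hmk hT).sum_lintegral_gap_le ν (b := fun _ => Finset.univ) (s := T)
    (t₀ := 0) (M := n) hT (fun _ => by simp) (fun t _ ht p i => by
      change twoPhaseWeight k T t p i = _
      rw [twoPhaseWeight, if_pos (by omega)]) (Or.inr (by simp)) (c := fun _ => i)
    (fun _ => Finset.mem_univ _) (W := fun _ => 1) (fun _ => le_rfl)
  simpa [hi] using h

theorem lintegral_gap_first_sample (ν : BanditInstance n) :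
    ∫⁻ ω, ENNReal.ofReal (ν.gap ((twoPhase hm hmk hT).alg.arm ω T))
        ∂(twoPhase hm hmk hT).alg.law ν
      = (T : ℝ≥0∞)⁻¹ * ∑ t ∈ Finset.range T,
        ∫⁻ ω, ENNReal.ofReal (ν.gap ((twoPhase hm hmk hT).alg.arm ω t))
          ∂(twoPhase hm hmk hT).alg.law ν := by
  have h := (twoPhase hm hmk hT).lintegral_empirical ν (t₁ := 0) (T := T) (u := T) (by simp)
    (fun p i => by
      change twoPhaseWeight k T T p i = _
      rw [twoPhaseWeight, if_neg (lt_irrefl T), if_pos rfl]) (W := fun _ => 1) measurable_const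
    fun j => ENNReal.ofReal (ν.gap j)
  simpa using h

theorem lintegral_gap_second_sample (ν : BanditInstance n) (W : Fin n → ℝ≥0∞) :
    ∫⁻ ω, W ω.1.1 * ENNReal.ofReal (ν.gap ((twoPhase hm hmk hT).alg.arm ω (T + 1 + T)))
        ∂(twoPhase hm hmk hT).alg.law ν
      = (T : ℝ≥0∞)⁻¹ * ∑ t ∈ Finset.range T,
        ∫⁻ ω, W ω.1.1 * ENNReal.ofReal (ν.gap ((twoPhase hm hmk hT).alg.arm ω (T + 1 + t)))
          ∂(twoPhase hm hmk hT).alg.law ν :=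
  (twoPhase hm hmk hT).lintegral_empirical ν le_rfl
    (fun p i => by
      change twoPhaseWeight k T (T + 1 + T) p i = _
      rw [twoPhaseWeight, if_neg (by omega), if_neg (by omega), if_neg (lt_irrefl _)])
    (measurable_of_countable W) fun j => ENNReal.ofReal (ν.gap j)

/-- The regret of the second phase, compared with an arm `c` of its active set. -/
theorem sum_gap_second_phase_le (ν : BanditInstance n) {c : Fin n × Fin n → Fin n}
    (hc : ∀ κ, c κ ∈ insert κ.2 (arc (k + 1) κ.1)) {W : Fin n → ℝ≥0∞} (hW : ∀ z, W z ≤ 1) :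
    ∑ t ∈ Finset.range T, ∫⁻ ω, W ω.1.1
        * ENNReal.ofReal (ν.gap ((twoPhase hm hmk hT).alg.arm ω (T + 1 + t)))
        ∂(twoPhase hm hmk hT).alg.law ν
      ≤ T * ∫⁻ ω, W ω.1.1
          * ENNReal.ofReal (ν.gap (c (ω.1.1, (twoPhase hm hmk hT).alg.arm ω T)))
          ∂(twoPhase hm hmk hT).alg.law ν
        + (∫⁻ z, W z ∂uniformArm n) * ENNReal.ofReal (3 * √((k + 2) * T)) := by
  have h := (twoPhase hm hmk hT).sum_lintegral_gap_le ν
    (b := fun κ : Fin n × Fin n => insert κ.2 (arc (k + 1) κ.1)) (s := T)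
    (t₀ := T + 1) (M := k + 2) hT
    (fun κ => (Finset.card_insert_le _ _).trans (by rw [card_arc (by omega)]))
    (fun t ht ht' p i => by
      change twoPhaseWeight k T t p i = _
      rw [twoPhaseWeight, if_neg (by omega), if_neg (by omega), if_pos ht'])
    (Or.inl (Nat.lt_succ_self T)) hc (W := fun κ => W κ.1) (fun κ => hW _)
  have hkey : ∀ ω, key T ((twoPhase hm hmk hT).state (T + 1) ω)
      = (ω.1.1, (twoPhase hm hmk hT).alg.arm ω T) := fun ω => by
    rw [key, Policy.state, BARAlgorithm.armAt_history, if_pos (Nat.lt_succ_self T)]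
  simp only [hkey] at h
  have hmarg := (twoPhase hm hmk hT).lintegral_initial ν (measurable_of_countable W)
  rw [hmarg] at h
  exact_mod_cast h

theorem regret_twoPhase_le (ν : BanditInstance n) :
    (twoPhase hm hmk hT).alg.regret ν ≤ ENNReal.ofReal (24 * √(n * T)) := by
  set π := twoPhase hm hmk hT with hπ
  set E : ℕ → ℝ≥0∞ := fun t => ∫⁻ ω, ENNReal.ofReal (ν.gap (π.alg.arm ω t)) ∂π.alg.law ν with hE
  have hT' : (T : ℝ≥0∞) ≠ 0 := by exact_mod_cast hT.ne'
  have hT1 : (T : ℝ≥0∞)⁻¹ ≤ 1 := ENNReal.inv_le_one.2 (by exact_mod_cast hT)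
  have h1 : ∑ t ∈ Finset.range T, E t ≤ ENNReal.ofReal (3 * √(n * T)) :=
    sum_gap_first_phase_le hm hmk hT ν
  have h2 : E T = (T : ℝ≥0∞)⁻¹ * ∑ t ∈ Finset.range T, E t :=
    lintegral_gap_first_sample hm hmk hT ν
  have h3 : E (T + 1 + T) = (T : ℝ≥0∞)⁻¹ * ∑ t ∈ Finset.range T, E (T + 1 + t) := by
    simpa using lintegral_gap_second_sample hm hmk hT ν fun _ => 1
  have h4 : ∑ t ∈ Finset.range T, E (T + 1 + t)
      ≤ T * E T + ENNReal.ofReal (3 * √((k + 2) * T)) := by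
    simpa using sum_gap_second_phase_le hm hmk hT ν (c := Prod.snd)
      (fun κ => Finset.mem_insert_self _ _) (W := fun _ => 1) fun _ => le_rfl
  have hTE : T * E T = ∑ t ∈ Finset.range T, E t := by
    rw [h2, ← mul_assoc, ENNReal.mul_inv_cancel hT' (ENNReal.natCast_ne_top T), one_mul]
  have hk : (k : ℝ) + 2 ≤ 4 * n := by
    have : k + 2 ≤ 4 * n := by omega
    exact_mod_cast this
  have h5 : ENNReal.ofReal (3 * √((k + 2) * T)) ≤ ENNReal.ofReal (6 * √(n * T)) := by
    refine ENNReal.ofReal_le_ofReal ?_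
    have h4' : √((4 : ℝ) * (n * T)) = 2 * √(n * T) := by
      rw [Real.sqrt_mul (by norm_num), show (4 : ℝ) = 2 ^ 2 by norm_num, Real.sqrt_sq (by norm_num)]
    have : √(((k : ℝ) + 2) * T) ≤ 2 * √(n * T) := by
      rw [← h4']
      refine Real.sqrt_le_sqrt ?_
      nlinarith [Nat.cast_nonneg (α := ℝ) T]
    linarith
  have h6 : ∑ t ∈ Finset.range T, E (T + 1 + t) ≤ ENNReal.ofReal (9 * √(n * T)) := by
    refine h4.trans ?_
    rw [hTE]
    refine (add_le_add h1 h5).trans (le_of_eq ?_)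
    rw [← ENNReal.ofReal_add (by positivity) (by positivity)]
    congr 1
    ring
  have h7 : E T ≤ ENNReal.ofReal (3 * √(n * T)) := by
    rw [h2]
    exact (mul_le_of_le_one_left' hT1).trans h1
  have h8 : E (T + 1 + T) ≤ ENNReal.ofReal (9 * √(n * T)) := by
    rw [h3]
    exact (mul_le_of_le_one_left' hT1).trans h6
  rw [π.alg.regret_eq_sum π.hasFixedSampleSize]
  change ∑ t ∈ Finset.range (T + 1 + T + 1), E t ≤ _
  rw [Finset.sum_range_succ, Finset.sum_range_add, Finset.sum_range_succ]
  refine (add_le_add (add_le_add (add_le_add h1 h7) h6) h8).trans (le_of_eq ?_)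
  rw [← ENNReal.ofReal_add (by positivity) (by positivity),
    ← ENNReal.ofReal_add (by positivity) (by positivity),
    ← ENNReal.ofReal_add (by positivity) (by positivity)]
  congr 1
  ring

/-- A best arm is at risk only if it lies in the random block. In that case it competes in the
second phase, so that the last arm pulled, which is retained, is nearly as good. -/
theorem expectedGap_twoPhase_le (ν : BanditInstance n) :
    (twoPhase hm hmk hT).alg.expectedGap ν
      ≤ ENNReal.ofReal (((k : ℝ) + 1) / n * (3 * √((k + 2) * T)) / T) := by
  set π := twoPhase hm hmk hT with hπ
  obtain ⟨i, hi⟩ := ν.exists_gap_eq_zero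
  have hTpos : (0 : ℝ) < T := by exact_mod_cast hT
  let W : Fin n → ℝ≥0∞ := fun z => if i ∈ arc (k + 1) z then 1 else 0
  have hstep : π.alg.expectedGap ν ≤ ∫⁻ ω, W ω.1.1
      * ENNReal.ofReal (ν.gap (π.alg.arm ω (T + 1 + T))) ∂π.alg.law ν := by
    refine lintegral_mono fun ω => ?_
    have hS : π.alg.sampleSize ω = (T + 1 + T + 1 : ℕ) := π.sampleSize_alg ω
    have hret : π.alg.retained ω
        = (dropped k (ω.1.1, π.alg.arm ω (T + 1 + T)))ᶜ := by
      rw [π.alg.retained_eq hS]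
      change (dropped k (key (T + 1 + T) (π.state (T + 1 + T + 1) ω)))ᶜ = _
      rw [key, Policy.state, BARAlgorithm.armAt_history, if_pos (Nat.lt_succ_self _)]
    simp only [hS, ENat.natCast_ne_top, if_false, hret]
    by_cases hmem : i ∈ arc (k + 1) ω.1.1
    · simp only [W, if_pos hmem, one_mul]
      exact ENNReal.ofReal_le_ofReal
        (ν.setGap_le_gap (Finset.mem_compl.2 (notMem_dropped k (ω.1.1, _))))
    · have h0 : i ∈ (dropped k (ω.1.1, π.alg.arm ω (T + 1 + T)))ᶜ :=
        Finset.mem_compl.2 fun h => hmem (Finset.mem_of_mem_erase h)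
      rw [ENNReal.ofReal_eq_zero.2 (hi ▸ ν.setGap_le_gap h0)]
      exact zero_le
  have hphase := sum_gap_second_phase_le hm hmk hT ν
    (c := fun κ => if i ∈ arc (k + 1) κ.1 then i else κ.2) (fun κ => by
      split_ifs with h
      exacts [Finset.mem_insert_of_mem h, Finset.mem_insert_self _ _])
    (W := W) fun z => by
      simp only [W]
      split_ifs
      exacts [le_rfl, zero_le]
  have hzero : ∀ ω : π.alg.Outcome, W ω.1.1 * ENNReal.ofReal
      (ν.gap (if i ∈ arc (k + 1) ω.1.1 then i else π.alg.arm ω T)) = 0 := fun ω => by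
    by_cases hmem : i ∈ arc (k + 1) ω.1.1 <;> simp [W, hmem, hi]
  have hWint : ∫⁻ z, W z ∂uniformArm n = ENNReal.ofReal (((k : ℝ) + 1) / n) := by
    have := lintegral_mem_arc (n := n) (q := k + 1) (by omega) i
    rw [this]
    push_cast
    rfl
  rw [← hπ] at hphase
  simp only [hzero, lintegral_zero, mul_zero, zero_add, hWint] at hphase
  refine hstep.trans ?_
  rw [lintegral_gap_second_sample hm hmk hT ν W]
  refine (mul_le_mul_right hphase _).trans (le_of_eq ?_)
  rw [← ENNReal.ofReal_mul (by positivity), ← ENNReal.ofReal_natCast T,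
    ← ENNReal.ofReal_inv_of_pos hTpos, ← ENNReal.ofReal_mul (by positivity)]
  congr 1
  ring

end twoPhase

theorem exists_isRBAR {n m : ℕ} {r : ℝ} (hm : 1 ≤ m) (hmn : m < n) (hr : 0 < r) :
    ∃ A : BARAlgorithm n m, A.IsRBAR r ∧ (∃ N : ℕ, A.HasFixedSampleSize N) ∧
      A.regretComplexity ≤ ENNReal.ofReal
        (264 * (((n : ℝ) - m) ^ 2 / (n * r) * (1 + √((m : ℝ) / ((n : ℝ) - m))))) := by
  have : NeZero n := ⟨by omega⟩
  obtain ⟨k, hmk⟩ : ∃ k, m + k = n := ⟨n - m, by omega⟩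
  have hk1 : (1 : ℝ) ≤ k := by exact_mod_cast (by omega : 1 ≤ k)
  have hk0 : (0 : ℝ) < k := by linarith
  have hn0 : (0 : ℝ) < n := by exact_mod_cast (by omega : 0 < n)
  have hnmk : (n : ℝ) = m + k := by exact_mod_cast hmk.symm
  have hkm : (n : ℝ) - m = k := by linarith
  rw [hkm]
  rcases lt_or_ge ((k : ℝ) / n) r with hlarge | hsmall
  · refine ⟨(blindPolicy hmk).alg, fun ν => (expectedGap_blindPolicy_le hmk ν).trans_lt ?_,
      ⟨_, (blindPolicy hmk).hasFixedSampleSize⟩, ?_⟩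
    · exact (ENNReal.ofReal_lt_ofReal_iff hr).2 hlarge
    · rw [regretComplexity_blindPolicy]
      exact zero_le
  -- `T` exceeds `108 k³ / (n r)²`, which makes the expected gap smaller than `r`
  set y : ℝ := 108 * k ^ 3 / (n * r) ^ 2 with hy
  have hy0 : 0 < y := by positivity
  set T : ℕ := ⌊y⌋₊ + 1 with hTdef
  have hT : 0 < T := Nat.succ_pos _
  have hTpos : (0 : ℝ) < T := by exact_mod_cast hT
  have hyT : y < T := by
    rw [hTdef]
    push_cast
    exact Nat.lt_floor_add_one y
  have hnr : n * r ≤ k := by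
    rw [le_div_iff₀ hn0] at hsmall
    linarith
  have hnr0 : 0 < n * r := by positivity
  have hTy : (T : ℝ) ≤ 121 * k ^ 3 / (n * r) ^ 2 := by
    have h1 : (T : ℝ) ≤ y + 1 := by
      rw [hTdef]
      push_cast
      linarith [Nat.floor_le hy0.le]
    have h2 : 1 ≤ k ^ 3 / (n * r) ^ 2 := by
      rw [one_le_div (by positivity)]
      calc (n * r) ^ 2 ≤ (k : ℝ) ^ 2 := by gcongr
        _ ≤ (k : ℝ) ^ 3 := pow_le_pow_right₀ hk1 (by norm_num)
    rw [hy, mul_div_assoc] at h1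
    rw [mul_div_assoc]
    linarith
  refine ⟨(twoPhase hm hmk hT).alg, fun ν => (expectedGap_twoPhase_le hm hmk hT ν).trans_lt ?_,
    ⟨_, (twoPhase hm hmk hT).hasFixedSampleSize⟩, iSup_le fun ν =>
      (regret_twoPhase_le hm hmk hT ν).trans (ENNReal.ofReal_le_ofReal ?_)⟩
  · rw [ENNReal.ofReal_lt_ofReal_iff hr, div_lt_iff₀ hTpos]
    have h1 : ((k : ℝ) + 1) / n * (3 * √((k + 2) * T)) ≤ 6 * k / n * √(3 * k * T) := by
      have h2 : √(((k : ℝ) + 2) * T) ≤ √(3 * k * T) := by gcongr; linarith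
      have h3 : ((k : ℝ) + 1) / n ≤ 2 * k / n := by gcongr; linarith
      calc ((k : ℝ) + 1) / n * (3 * √((k + 2) * T)) ≤ 2 * k / n * (3 * √(3 * k * T)) := by gcongr
        _ = 6 * k / n * √(3 * k * T) := by ring
    refine h1.trans_lt (lt_of_pow_lt_pow_left₀ 2 (by positivity) ?_)
    rw [mul_pow, Real.sq_sqrt (by positivity)]
    rw [hy, div_lt_iff₀ (by positivity)] at hyT
    calc (6 * (k : ℝ) / n) ^ 2 * (3 * k * T) = 108 * k ^ 3 * (T / n ^ 2) := by
          field_simp; ring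
      _ < T * (n * r) ^ 2 * (T / n ^ 2) := by gcongr
      _ = (r * T) ^ 2 := by field_simp
  · have h1 : √((n : ℝ) * T) ≤ 11 * (k ^ 2 / (n * r) * √(n / k)) := by
      refine Real.sqrt_le_iff.2 ⟨by positivity, ?_⟩
      calc (n : ℝ) * T ≤ n * (121 * k ^ 3 / (n * r) ^ 2) := by gcongr
        _ = (11 * (k ^ 2 / (n * r) * √(n / k))) ^ 2 := by
            rw [mul_pow 11, mul_pow _ (√((n : ℝ) / k)), Real.sq_sqrt (by positivity)]
            field_simp
            norm_num
    have h2 : √((n : ℝ) / k) ≤ 1 + √((m : ℝ) / k) := by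
      have : (n : ℝ) / k = 1 + m / k := by rw [hnmk]; field_simp; ring
      rw [this]
      refine Real.sqrt_le_iff.2 ⟨by positivity, ?_⟩
      have := Real.sq_sqrt (show (0 : ℝ) ≤ m / k by positivity)
      have := Real.sqrt_nonneg ((m : ℝ) / k)
      linarith [show (1 + √((m : ℝ) / k)) ^ 2 = 1 + 2 * √((m : ℝ) / k) + √((m : ℝ) / k) ^ 2 by ring]
    calc 24 * √((n : ℝ) * T) ≤ 24 * (11 * (k ^ 2 / (n * r) * √(n / k))) := by gcongr
      _ = 264 * (k ^ 2 / (n * r) * √(n / k)) := by ring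
      _ ≤ 264 * (k ^ 2 / (n * r) * (1 + √((m : ℝ) / k))) := by gcongr

theorem theorem3 :
    (∃ C : ℝ, 0 < C ∧ ∀ (n m : ℕ) (r : ℝ), 1 ≤ m → m < n → 0 < r →
      ∃ A : BARAlgorithm n m, A.IsRBAR r ∧ (∃ N : ℕ, A.HasFixedSampleSize N) ∧
        A.regretComplexity ≤
          ENNReal.ofReal (C * (((n : ℝ) - m) ^ 2 / (n * r) * (1 + √((m : ℝ) / ((n : ℝ) - m)))))) ∧
    (∀ β : ℝ, 0 < β → β < 1 → ∃ c : ℝ, 0 < c ∧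
      ∀ (n m : ℕ) (r : ℝ), 1 ≤ m → m < n → 0 < r → r ≤ (1 - β) * (((n : ℝ) - m) / n) →
        ∀ A : BARAlgorithm n m, A.IsRBAR r →
          ENNReal.ofReal (c * (((n : ℝ) - m) ^ 2 / (n * r))) ≤ A.regretComplexity) := by
  refine ⟨⟨264, by norm_num, fun n m r hm hmn hr => exists_isRBAR hm hmn hr⟩, fun β hβ hβ1 =>
    ⟨β ^ 5 / 131072, by positivity, fun n m r hm hmn hr hrk A hA =>
      A.le_regretComplexity_of_isRBAR hβ hβ1 hm hmn hr hrk hA⟩⟩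

end
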